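/- For C*-algebras $A$ and $F$ with $F$ finite-dimensional, a completely positive map $\varphi : F \to A$ has strict order zero if $\varphi(e)\varphi(f) = 0$ for any two orthogonal minimal projections $e, f \in F$. A completely positive map $\varphi : \bigoplus_{i=1}^s M_{r_i}(\mathbb{C}) \to A$ is $n$-decomposable if there is a partition $\{1,\dots,s\} = I_0 \sqcup \dots \sqcup I_n$ into (possibly empty) sets such that the restriction of $\varphi$ to $\bigoplus_{i\in I_j} M_{r_i}(\mathbb{C})$ has strict order zero for every $j$. The decomposition rank $\mathrm{dr}\,A \in \{0,1,2,\dots,\infty\}$ is the least integer $n \ge 0$ such that for all $b_1,\dots,b_m \in A$ and $\varepsilon > 0$ there are $F = \bigoplus_{i=1}^s M_{r_i}(\mathbb{C})$ and completely positive contractive maps $\psi : A \to F$ and $\varphi : F \to A$ with $\|\varphi(\psi(b_k)) - b_k\| < \varepsilon$ for $k = 1,\dots,m$ and such that $\varphi$ is $n$-decomposable; $\mathrm{dr}\,A = \infty$ if no such $n$ exists. **Proposition.** Let $A$ be a separable C*-algebra and let $\tilde A = A \oplus \mathbb{C}\mathbf{1}$ be the C*-algebra obtained from $A$ by adjoining a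 unit (also if $A$ already has one). Then $\mathrm{dr}\,A = \mathrm{dr}\,\tilde A$. (If one prefers to set $\tilde A = A$ for unital $A$, the equality is trivial in that case.) -/

import Mathlib

open scoped ComplexOrder CStarAlgebra

/-- `p` is a minimal projection: a nonzero projection whose only subprojections are `0` and `p`. -/
def IsMinimalProjection {F : Type*} [NonUnitalNonAssocSemiring F] [Star F] (p : F) : Prop :=
  IsStarProjection p ∧ p ≠ 0 ∧ ∀ q : F, IsStarProjection q → p * q = q → q = 0 ∨ q = p

/-- The strict order of the linear map `φ : F → A` does not exceed `n`: among any `n + 2` pairwise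
orthogonal minimal projections of `F` there are two whose images under `φ` are orthogonal.
(This is used for completely positive maps `φ` on finite-dimensional `F` only. The images are then
positive, so orthogonality means that their product is zero.) -/
def StrictOrderLE {F A : Type*} [NonUnitalNonAssocSemiring F] [Star F] [Module ℂ F]
    [NonUnitalNonAssocSemiring A] [Module ℂ A] (φ : F →ₗ[ℂ] A) (n : ℕ) : Prop :=
  ∀ e : Fin (n + 2) → F, (∀ k, IsMinimalProjection (e k)) → (∀ k l, k ≠ l → e k * e l = 0) →
    ∃ k l, k ≠ l ∧ φ (e k) * φ (e l) = 0

/-- The C⋆-algebra `⨁ i, M_{r i}(ℂ)`, with its C⋆-norm. (Blocks with `r i = 0` are zero summands and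
may be discarded.) -/
abbrev MatrixSum {ι : Type} (r : ι → ℕ) : Type :=
  ∀ i, CStarMatrix (Fin (r i)) (Fin (r i)) ℂ

open Classical in
/-- The inclusion of `⨁ i ∈ I, M_{r i}(ℂ)` into `⨁ i, M_{r i}(ℂ)` (extension by zero). -/
noncomputable def MatrixSum.incl {ι : Type} (r : ι → ℕ) (I : Set ι) :
    MatrixSum (fun i : I => r i) →ₗ[ℂ] MatrixSum r where
  toFun x i := if h : i ∈ I then x ⟨i, h⟩ else 0
  map_add' x y := by
    funext i
    by_cases h : i ∈ I <;> simp [h]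
  map_smul' c x := by
    funext i
    by_cases h : i ∈ I <;> simp [h]

section

variable {A : Type*} [NonUnitalCStarAlgebra A] [PartialOrder A] [StarOrderedRing A]

/-- A completely positive map `φ : ⨁ i, M_{r i}(ℂ) → A` is `n`-decomposable if the index set is a
disjoint union of (possibly empty) sets `I_0, …, I_n`, here given as the fibres of a map `c`, such
that each restriction of `φ` to `⨁ i ∈ I_j, M_{r i}(ℂ)` has strict order zero. -/
def IsDecomposable {ι : Type} [Fintype ι] {r : ι → ℕ} (n : ℕ) (φ : MatrixSum r →CP A) : Prop :=
  ∃ c : ι → Fin (n + 1), ∀ j : Fin (n + 1),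
    StrictOrderLE (φ.toLinearMap ∘ₗ MatrixSum.incl r {i | c i = j}) 0

variable (A) in
/-- The decomposition rank of `A` is at most `n`: for all `b_1, …, b_m` in `A` and `ε > 0` there are
a finite-dimensional C⋆-algebra `F` and completely positive contractive maps `ψ : A → F` and
`φ : F → A` with `‖φ (ψ b_k) - b_k‖ < ε` for all `k` and such that `φ` is `n`-decomposable. -/
def DecompositionRankLE (n : ℕ) : Prop :=
  ∀ (m : ℕ) (b : Fin m → A) (ε : ℝ), 0 < ε →
    ∃ (s : ℕ) (r : Fin s → ℕ) (ψ : A →CP MatrixSum r) (φ : MatrixSum r →CP A),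
      (∀ a, ‖ψ a‖ ≤ ‖a‖) ∧ (∀ x, ‖φ x‖ ≤ ‖x‖) ∧
      (∀ k, ‖φ (ψ (b k)) - b k‖ < ε) ∧ IsDecomposable n φ

variable (A) in
/-- The decomposition rank of `A`: the least `n` with `DecompositionRankLE A n`, and `∞` if there is
no such `n`. -/
noncomputable def decompositionRank : ℕ∞ :=
  ⨅ (n : ℕ) (_ : DecompositionRankLE A n), (n : ℕ∞)

end

/-! ### Completely positive maps -/

section CompletePositivity

/-! Write Ã for the unitization. Each inequality converts an approximation (ψ, φ) of one algebra
into one of the other with the same colours. Order zero is used in the form `OrthogonalOnColors`: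
orthogonal projections of one colour have orthogonal images. So if e ≤ q are projections of one
colour, φ(e)φ(q - e) = 0 = φ(q - e)φ(e), hence φ(e) commutes with φ(q) and with k = `cutoff θ (φ
q)`. Therefore kφ(·)k keeps orthogonality below q (`cutoff_conjugate_mul_eq_zero`), and it is close
to φ on 0 ≤ x ≤ q (`norm_cutoff_conjugate_sub_le`).

Let v be an approximate unit and p the spectral projection of ψ(v²) for [η, ∞). If 0 ≤ b ≤ v², then
ψ(b) ≤ ψ(v²) almost lives on p. Moreover ηp ≤ ψ(v²), so ηφ(p) is almost below v².

For dr A ≤ dr Ã, the last fact makes the character of Ã at most θ on the image of each colour part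
of p. Cutting down each colour below θ then kills the character, and the new map takes values in A.

For dr Ã ≤ dr A, a one-dimensional block is added whose image is close to D = 1 - φ(p). It receives
colour 0, so its image must be orthogonal to that of colour 0. Here p cuts colour 0 down to a
projection q and leaves the other colours whole. With d = φ(q), order zero gives Dd = (1 - φ(1))d.
Now 1 - φ(1) is almost below 1 - u² for an approximate unit u with uv ≈ v, while ηd is almost below
v²; hence Dd ≈ 0 (`norm_mul_sq_le`). Compressing φ by k and D by 1 - g with (1 - g)k = 0 makes the
orthogonality exact at small cost.

The criterion `decompositionRankLE_of_approx` absorbs the corner at p and the slight failure of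
contractivity. -/

lemma nonneg_iff_exists_star_mul_self {A : Type*} [NonUnitalCStarAlgebra A] [PartialOrder A]
    [StarOrderedRing A] {a : A} : 0 ≤ a ↔ ∃ b, a = star b * b :=
  CStarAlgebra.nonneg_iff_eq_star_mul_self

variable {A B C : Type*} [NonUnitalCStarAlgebra A] [PartialOrder A] [StarOrderedRing A]
  [NonUnitalCStarAlgebra B] [PartialOrder B] [StarOrderedRing B]
  [NonUnitalCStarAlgebra C] [PartialOrder C] [StarOrderedRing C]

/-- Complete positivity as a predicate on linear maps. -/
def IsCompletelyPositive (f : A →ₗ[ℂ] B) : Prop :=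
  ∀ (k : ℕ) (M : CStarMatrix (Fin k) (Fin k) A), 0 ≤ M → 0 ≤ M.map f

/-- A linear map with `IsCompletelyPositive` as a bundled completely positive map. -/
def IsCompletelyPositive.toCP {f : A →ₗ[ℂ] B} (hf : IsCompletelyPositive f) : A →CP B where
  toLinearMap := f
  map_cstarMatrix_nonneg' := hf

lemma CompletelyPositiveMap.isCompletelyPositive (f : A →CP B) :
    IsCompletelyPositive f.toLinearMap :=
  f.map_cstarMatrix_nonneg'

lemma IsCompletelyPositive.comp {g : B →ₗ[ℂ] C} {f : A →ₗ[ℂ] B} (hg : IsCompletelyPositive g)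
    (hf : IsCompletelyPositive f) : IsCompletelyPositive (g ∘ₗ f) :=
  fun k M hM => hg k _ (hf k M hM)

lemma IsCompletelyPositive.add {f g : A →ₗ[ℂ] B} (hf : IsCompletelyPositive f)
    (hg : IsCompletelyPositive g) : IsCompletelyPositive (f + g) :=
  fun k M hM => add_nonneg (hf k M hM) (hg k M hM)

lemma IsCompletelyPositive.zero : IsCompletelyPositive (0 : A →ₗ[ℂ] B) :=
  fun _ _ _ => le_refl (0 : CStarMatrix _ _ B)

lemma IsCompletelyPositive.sum {ι : Type*} (s : Finset ι) {f : ι → A →ₗ[ℂ] B}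
    (hf : ∀ i, IsCompletelyPositive (f i)) : IsCompletelyPositive (∑ i ∈ s, f i) := by
  classical
  induction s using Finset.induction_on with
  | empty => simpa using IsCompletelyPositive.zero
  | insert i s hi ih => rw [Finset.sum_insert hi]; exact (hf i).add ih

lemma IsCompletelyPositive.smul {f : A →ₗ[ℂ] B} (hf : IsCompletelyPositive f) {t : ℝ}
    (ht : 0 ≤ t) : IsCompletelyPositive ((t : ℂ) • f) := by
  intro k M hM
  obtain ⟨N, hN⟩ := nonneg_iff_exists_star_mul_self.mp (hf k M hM)
  refine nonneg_iff_exists_star_mul_self.mpr ⟨((Real.sqrt t : ℝ) : ℂ) • N, ?_⟩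
  have h1 : M.map ⇑((t : ℂ) • f) = (t : ℂ) • M.map f := rfl
  rw [h1, hN, star_smul, smul_mul_smul_comm]
  congr 1
  rw [Complex.star_def, Complex.conj_ofReal, ← Complex.ofReal_mul, Real.mul_self_sqrt ht]

lemma IsCompletelyPositive.starHom (f : A →⋆ₙₐ[ℂ] B) :
    IsCompletelyPositive (f : A →ₗ[ℂ] B) :=
  fun k M hM => CompletelyPositiveMapClass.map_cstarMatrix_nonneg' f k M hM

/-- The map `x ↦ star a * x * a`. -/
noncomputable def conjugation (a : A) : A →ₗ[ℂ] A :=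
  LinearMap.mulRight ℂ a ∘ₗ LinearMap.mulLeft ℂ (star a)

omit [PartialOrder A] [StarOrderedRing A] in
@[simp] lemma conjugation_apply (a x : A) : conjugation a x = star a * x * a := rfl

lemma IsCompletelyPositive.conjugation (a : A) : IsCompletelyPositive (conjugation a) := by
  intro k M hM
  obtain ⟨N, rfl⟩ := nonneg_iff_exists_star_mul_self.mp hM
  refine nonneg_iff_exists_star_mul_self.mpr ⟨N.map (· * a), ?_⟩
  ext i j
  simp [CStarMatrix.mul_apply, CStarMatrix.star_apply, mul_assoc]

/-- Homomorphisms respect functional calculus, so the negative part of a is sent to that of f a,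
which is zero. -/
lemma nonneg_of_map_nonneg (f : A →⋆ₙₐ[ℂ] B) (hf : Function.Injective f) {a : A}
    (ha : 0 ≤ f a) : 0 ≤ a := by
  have hsa : IsSelfAdjoint a := by
    apply hf
    rw [map_star]
    exact (IsSelfAdjoint.of_nonneg ha).star_eq
  have hc : Continuous f := (NonUnitalStarAlgHom.isometry f hf).continuous
  have h : f (a⁻) = (f a)⁻ := by
    rw [CFC.negPart_def, CFC.negPart_def]
    exact NonUnitalStarAlgHomClass.map_cfcₙ (S := ℂ) f _ a (by fun_prop) (by simp) hc hsa
      (hsa.map f)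
  rw [CFC.negPart_eq_zero_iff (f a) (hsa.map f) |>.mpr ha] at h
  exact (CFC.negPart_eq_zero_iff a hsa).mp (hf (by rw [h, map_zero]))

/-- Positivity may be tested in a larger algebra; this serves A inside its unitization and corners
inside matrix sums. -/
lemma IsCompletelyPositive.of_comp_injective (g : B →⋆ₙₐ[ℂ] C) (hg : Function.Injective g)
    {f : A →ₗ[ℂ] B} (h : IsCompletelyPositive ((g : B →ₗ[ℂ] C) ∘ₗ f)) :
    IsCompletelyPositive f := by
  intro k M hM
  refine nonneg_of_map_nonneg (CStarMatrix.mapₙₐ g) ?_ (h k M hM)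
  intro x y hxy
  ext i j
  exact hg (congrFun (congrFun hxy i) j)

end CompletePositivity

/-! ### Norms of completely positive maps -/

section Contractive

variable {A B : Type*} [CStarAlgebra A] [PartialOrder A] [StarOrderedRing A]
  [CStarAlgebra B] [PartialOrder B] [StarOrderedRing B]

lemma IsCompletelyPositive.nonneg {A B : Type*} [NonUnitalCStarAlgebra A] [PartialOrder A]
    [StarOrderedRing A] [NonUnitalCStarAlgebra B] [PartialOrder B] [StarOrderedRing B]
    {f : A →ₗ[ℂ] B} (hf : IsCompletelyPositive f) {x : A}
    (hx : 0 ≤ x) : 0 ≤ f x := by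
  simpa using! map_nonneg hf.toCP hx

lemma IsCompletelyPositive.mono {A B : Type*} [NonUnitalCStarAlgebra A] [PartialOrder A]
    [StarOrderedRing A] [NonUnitalCStarAlgebra B] [PartialOrder B] [StarOrderedRing B]
    {f : A →ₗ[ℂ] B} (hf : IsCompletelyPositive f) {x y : A}
    (h : x ≤ y) : f x ≤ f y := by
  have := hf.nonneg (sub_nonneg.mpr h)
  rwa [map_sub, sub_nonneg] at this

lemma norm_le_one_of_star_mul_self_le_one {y : B} (h : star y * y ≤ 1) : ‖y‖ ≤ 1 := by
  have h1 := (CStarAlgebra.norm_le_one_iff_of_nonneg (star y * y) (star_mul_self_nonneg y)).mpr h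
  rw [CStarRing.norm_star_mul_self] at h1
  nlinarith [norm_nonneg y]

lemma star_mul_self_le_one {x : A} (hx : ‖x‖ ≤ 1) : star x * x ≤ 1 := by
  refine (CStarAlgebra.norm_le_one_iff_of_nonneg (star x * x) (star_mul_self_nonneg x)).mp ?_
  rw [CStarRing.norm_star_mul_self]
  nlinarith [norm_nonneg x]

/-- Evaluating the positive matrix [[f 1, y], [y*, f 1]], y = f x, at the column (-y, 1) gives 2y*y
≤ y*(f 1)y + f 1 ≤ y*y + 1. -/
lemma IsCompletelyPositive.norm_apply_le_one {f : A →ₗ[ℂ] B} (hf : IsCompletelyPositive f)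
    (h1 : f 1 ≤ 1) {x : A} (hx : ‖x‖ ≤ 1) : ‖f x‖ ≤ 1 := by
  obtain ⟨d, hd⟩ := nonneg_iff_exists_star_mul_self.mp
    (sub_nonneg.mpr (star_mul_self_le_one (x := star x) (by rwa [norm_star])))
  rw [star_star] at hd
  -- The matrix `[[1, x], [x*, 1]]` is positive.
  let N : CStarMatrix (Fin 2) (Fin 2) A := CStarMatrix.ofMatrix !![star x, 1; d, 0]
  have hf2 := hf 2 (star N * N) (star_mul_self_nonneg N)
  obtain ⟨L, hL⟩ := nonneg_iff_exists_star_mul_self.mp hf2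
  have e (i j : Fin 2) := congrFun (congrFun hL i) j
  have e00 := e 0 0
  have e01 := e 0 1
  have e10 := e 1 0
  have e11 := e 1 1
  simp [CStarMatrix.mul_apply, CStarMatrix.star_apply, N] at e00 e01 e10 e11
  have hdd : x * star x + star d * d = 1 := by rw [← hd]; abel
  rw [← map_add, hdd] at e00
  set y := f x with hy
  have hys : f (star x) = star y := by rw [e10, e01]; simp
  apply norm_le_one_of_star_mul_self_le_one
  have key : star y * f 1 * y - star y * y - star y * y + f 1 =
      star (L 0 0 * (-y) + L 0 1) * (L 0 0 * (-y) + L 0 1) +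
      star (L 1 0 * (-y) + L 1 1) * (L 1 0 * (-y) + L 1 1) := by
    have t1 : star y * f 1 * y = star y * (star (L 0 0) * L 0 0 + star (L 1 0) * L 1 0) * y := by
      rw [← e00]
    have t2 : star y * y = star y * (star (L 0 0) * L 0 1 + star (L 1 0) * L 1 1) := by
      rw [← e01]
    have t3 : star y * y = (star (L 0 1) * L 0 0 + star (L 1 1) * L 1 0) * y := by
      rw [← e10, hys]
    rw [t1]
    nth_rewrite 1 [t2]
    rw [t3, e11]
    simp only [star_add, star_mul, star_neg]
    noncomm_ring
  have h2 : 0 ≤ star y * f 1 * y - star y * y - star y * y + f 1 := by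
    rw [key]; exact add_nonneg (star_mul_self_nonneg _) (star_mul_self_nonneg _)
  have h3 : star y * f 1 * y ≤ star y * 1 * y := star_left_conjugate_le_conjugate h1 y
  rw [mul_one] at h3
  have h4 : star y * f 1 * y - star y * y - star y * y + f 1 ≤
      star y * y - star y * y - star y * y + 1 := by gcongr
  have h5 := h2.trans h4
  rw [sub_self, zero_sub, neg_add_eq_sub, sub_nonneg] at h5
  exact h5

/-- A completely positive map with `f 1 ≤ t` has norm at most `t`. -/
lemma IsCompletelyPositive.norm_apply_le {f : A →ₗ[ℂ] B} (hf : IsCompletelyPositive f) {t : ℝ}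
    (ht : 0 < t) (h1 : f 1 ≤ algebraMap ℝ B t) (x : A) : ‖f x‖ ≤ t * ‖x‖ := by
  have hg := hf.smul (t := t⁻¹) (by positivity)
  have hg1 : (((t⁻¹ : ℝ) : ℂ) • f) 1 ≤ 1 := by
    have := smul_le_smul_of_nonneg_left h1 (show 0 ≤ t⁻¹ by positivity)
    rw [Algebra.algebraMap_eq_smul_one, smul_smul, inv_mul_cancel₀ ht.ne', one_smul] at this
    rwa [LinearMap.smul_apply, Complex.coe_smul]
  rcases eq_or_ne x 0 with rfl | hx
  · simp
  have hx' : 0 < ‖x‖ := norm_pos_iff.mpr hx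
  have := hg.norm_apply_le_one hg1 (x := ((‖x‖⁻¹ : ℝ) : ℂ) • x)
    (by rw [norm_smul]; simp [hx'.ne'])
  rw [map_smul, LinearMap.smul_apply, norm_smul, norm_smul] at this
  simp only [Complex.norm_real, norm_inv, Real.norm_eq_abs, abs_of_pos ht, abs_of_pos hx'] at this
  rwa [← mul_assoc, ← mul_inv, inv_mul_le_iff₀ (by positivity), mul_one, mul_comm] at this

end Contractive

/-! ### Norm estimates for positive elements -/

section Estimates

variable {B : Type*} [CStarAlgebra B] [PartialOrder B] [StarOrderedRing B]

lemma le_smul_one_of_norm_le {a : B} {t : ℝ} (ha : IsSelfAdjoint a) (h : ‖a‖ ≤ t) :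
    a ≤ t • 1 := by
  rw [← Algebra.algebraMap_eq_smul_one]
  exact ha.le_algebraMap_norm_self.trans (algebraMap_mono B h)

lemma le_add_smul_one_of_norm_sub_le {a b : B} {t : ℝ} (ha : IsSelfAdjoint a)
    (hb : IsSelfAdjoint b) (h : ‖a - b‖ ≤ t) : a ≤ b + t • 1 := by
  have := le_smul_one_of_norm_le (ha.sub hb) h
  rwa [sub_le_iff_le_add'] at this

lemma mul_self_le_self {y : B} (hy : 0 ≤ y) (hy1 : y ≤ 1) : y * y ≤ y := by
  simpa [sq] using CStarAlgebra.pow_antitone hy hy1 (show 1 ≤ 2 by norm_num)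

lemma norm_mul_le_sqrt_of_le {c y z : B} (hy : 0 ≤ y) (hyc : y ≤ c) (hy1 : y ≤ 1)
    (hz : IsSelfAdjoint z) {t : ℝ} (h : ‖z * c * z‖ ≤ t) : ‖y * z‖ ≤ Real.sqrt t := by
  apply Real.le_sqrt_of_sq_le
  refine le_trans ?_ h
  rw [sq, ← CStarRing.norm_star_mul_self]
  refine CStarAlgebra.norm_le_norm_of_nonneg_of_le (star_mul_self_nonneg _) ?_
  rw [star_mul, hz.star_eq, (IsSelfAdjoint.of_nonneg hy).star_eq]
  have := hz.conjugate_le_conjugate ((mul_self_le_self hy hy1).trans hyc)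
  simpa only [mul_assoc] using this

/-- If k is almost a unit for c, it is almost a unit for every contraction y below c, since y² ≤ y ≤
c. It is applied to spectral projections and to cutoffs. -/
lemma norm_conjugate_sub_le {c y k : B} (hy : 0 ≤ y) (hyc : y ≤ c) (hy1 : y ≤ 1)
    (hk : IsSelfAdjoint k) (hk1 : ‖k‖ ≤ 1) {t : ℝ} (h : ‖(1 - k) * c * (1 - k)‖ ≤ t) :
    ‖k * y * k - y‖ ≤ 2 * Real.sqrt t := by
  have hz : IsSelfAdjoint (1 - k) := (IsSelfAdjoint.one B).sub hk
  have h1 := norm_mul_le_sqrt_of_le hy hyc hy1 hz h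
  have h2 : ‖(1 - k) * y‖ ≤ Real.sqrt t := by
    rw [← norm_star, star_mul, hz.star_eq, (IsSelfAdjoint.of_nonneg hy).star_eq]
    exact h1
  have e : k * y * k - y = -((1 - k) * y * k) - y * (1 - k) := by noncomm_ring
  rw [e]
  calc ‖-((1 - k) * y * k) - y * (1 - k)‖ ≤ ‖(1 - k) * y * k‖ + ‖y * (1 - k)‖ := by
        refine (norm_sub_le _ _).trans ?_
        rw [norm_neg]
    _ ≤ ‖(1 - k) * y‖ * ‖k‖ + ‖y * (1 - k)‖ := by gcongr; exact norm_mul_le _ _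
    _ ≤ Real.sqrt t * 1 + Real.sqrt t := by gcongr
    _ = 2 * Real.sqrt t := by ring

lemma norm_sqrt_mul_sqrt_sq {a : B} (ha : 0 ≤ a) (b : B) :
    ‖CFC.sqrt a * CFC.sqrt b‖ ^ 2 = ‖CFC.sqrt b * a * CFC.sqrt b‖ := by
  rw [sq, ← CStarRing.norm_star_mul_self, star_mul,
    (IsSelfAdjoint.of_nonneg (CFC.sqrt_nonneg a)).star_eq,
    (IsSelfAdjoint.of_nonneg (CFC.sqrt_nonneg b)).star_eq]
  congr 1
  rw [mul_assoc, ← mul_assoc (CFC.sqrt a), CFC.sqrt_mul_sqrt_self a, mul_assoc]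

lemma norm_sqrt_le_one {a : B} (ha : 0 ≤ a) (h : a ≤ 1) : ‖CFC.sqrt a‖ ≤ 1 := by
  apply norm_le_one_of_star_mul_self_le_one
  rwa [(IsSelfAdjoint.of_nonneg (CFC.sqrt_nonneg a)).star_eq, CFC.sqrt_mul_sqrt_self a]

lemma norm_conjugate_sqrt_comm {a b : B} (ha : 0 ≤ a) (hb : 0 ≤ b) :
    ‖CFC.sqrt b * a * CFC.sqrt b‖ = ‖CFC.sqrt a * b * CFC.sqrt a‖ := by
  rw [← norm_sqrt_mul_sqrt_sq ha b, ← norm_sqrt_mul_sqrt_sq hb a]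
  congr 1
  rw [← norm_star, star_mul, (IsSelfAdjoint.of_nonneg (CFC.sqrt_nonneg a)).star_eq,
    (IsSelfAdjoint.of_nonneg (CFC.sqrt_nonneg b)).star_eq]

omit [PartialOrder B] [StarOrderedRing B] in
lemma norm_conjugate_add_smul_one_le {b a : B} (hb : ‖b‖ ≤ 1) {t : ℝ} (ht : 0 ≤ t) :
    ‖b * (a + t • 1) * b‖ ≤ ‖b * a * b‖ + t := by
  rw [mul_add, add_mul]
  refine (norm_add_le _ _).trans ?_
  gcongr
  rw [mul_smul_comm, mul_one, smul_mul_assoc, norm_smul, Real.norm_of_nonneg ht]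
  have : ‖b * b‖ ≤ 1 := (norm_mul_le _ _).trans (by nlinarith [norm_nonneg b])
  nlinarith

lemma norm_conjugate_mono {a a' s : B} (ha : 0 ≤ a) (h : a ≤ a') (hs : IsSelfAdjoint s) :
    ‖s * a * s‖ ≤ ‖s * a' * s‖ :=
  CStarAlgebra.norm_le_norm_of_nonneg_of_le (hs.conjugate_nonneg ha) (hs.conjugate_le_conjugate h)

/-- Two positive contractions that are almost dominated by almost orthogonal positive elements are
almost orthogonal. -/
lemma norm_mul_sq_le {x x' y v : B} (hx : 0 ≤ x) (hx1 : x ≤ 1) (hy : 0 ≤ y) (hy1 : y ≤ 1)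
    (hx' : 0 ≤ x') (hx'1 : x' ≤ 1) (hv : IsSelfAdjoint v) {d e η : ℝ} (hd : 0 ≤ d) (hη : 0 < η)
    (h1 : x ≤ x' + d • 1) (h2 : η • y ≤ v * v + d • 1) (h3 : ‖v * x' * v‖ ≤ e) :
    ‖x * y‖ ^ 2 ≤ d + η⁻¹ * (d + e) := by
  have sa (b : B) : IsSelfAdjoint (CFC.sqrt b) := .of_nonneg (CFC.sqrt_nonneg b)
  have e1 : ‖x * y‖ ≤ ‖CFC.sqrt x * CFC.sqrt y‖ := by
    have : x * y = CFC.sqrt x * (CFC.sqrt x * CFC.sqrt y) * CFC.sqrt y := by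
      nth_rewrite 1 [← CFC.sqrt_mul_sqrt_self x, ← CFC.sqrt_mul_sqrt_self y]
      simp only [mul_assoc]
    rw [this]
    calc _ ≤ ‖CFC.sqrt x‖ * ‖CFC.sqrt x * CFC.sqrt y‖ * ‖CFC.sqrt y‖ :=
          (norm_mul_le _ _).trans (by gcongr; exact norm_mul_le _ _)
      _ ≤ 1 * ‖CFC.sqrt x * CFC.sqrt y‖ * 1 := by
          gcongr
          · exact norm_sqrt_le_one hx hx1
          · exact norm_sqrt_le_one hy hy1
      _ = _ := by ring
  have e2 : ‖CFC.sqrt x' * (η • y) * CFC.sqrt x'‖ ≤ e + d := by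
    refine (norm_conjugate_mono (smul_nonneg hη.le hy) h2 (sa x')).trans ?_
    refine (norm_conjugate_add_smul_one_le (norm_sqrt_le_one hx' hx'1) hd).trans ?_
    gcongr
    refine le_trans (le_of_eq ?_) h3
    -- The two elements are w*w and ww* for w = v√x', so their norms agree.
    have e4 : CFC.sqrt x' * (v * v) * CFC.sqrt x' =
        star (v * CFC.sqrt x') * (v * CFC.sqrt x') := by
      rw [star_mul, hv.star_eq, (sa x').star_eq]; simp only [mul_assoc]
    have e5 : v * x' * v = (v * CFC.sqrt x') * star (v * CFC.sqrt x') := by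
      rw [star_mul, hv.star_eq, (sa x').star_eq]
      nth_rewrite 1 [← CFC.sqrt_mul_sqrt_self x']
      simp only [mul_assoc]
    rw [e4, e5, CStarRing.norm_star_mul_self, CStarRing.norm_self_mul_star]
  have e3 : ‖CFC.sqrt x' * y * CFC.sqrt x'‖ ≤ η⁻¹ * (d + e) := by
    rw [mul_smul_comm, smul_mul_assoc, norm_smul, Real.norm_of_nonneg hη.le] at e2
    rw [le_inv_mul_iff₀ hη, add_comm d]
    exact e2
  calc ‖x * y‖ ^ 2 ≤ ‖CFC.sqrt x * CFC.sqrt y‖ ^ 2 := by gcongr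
    _ = ‖CFC.sqrt y * x * CFC.sqrt y‖ := norm_sqrt_mul_sqrt_sq hx y
    _ ≤ ‖CFC.sqrt y * (x' + d • 1) * CFC.sqrt y‖ := norm_conjugate_mono hx h1 (sa y)
    _ ≤ ‖CFC.sqrt y * x' * CFC.sqrt y‖ + d :=
        norm_conjugate_add_smul_one_le (norm_sqrt_le_one hy hy1) hd
    _ = ‖CFC.sqrt x' * y * CFC.sqrt x'‖ + d := by rw [norm_conjugate_sqrt_comm hx' hy]
    _ ≤ d + η⁻¹ * (d + e) := by linarith

end Estimates

lemma one_sub_cfc {A : Type*} [CStarAlgebra A] {a : A} (ha : IsSelfAdjoint a) (f : ℝ → ℝ)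
    (hf : ContinuousOn f (spectrum ℝ a)) : 1 - cfc f a = cfc (fun t => 1 - f t) a := by
  rw [cfc_sub (fun _ => 1) f a (by fun_prop) hf, cfc_const_one ℝ a]

/-! ### Cutting off the spectrum near zero -/

section Cutoff

variable {B : Type*} [CStarAlgebra B] [PartialOrder B] [StarOrderedRing B]

/-- The functional calculus of `c` for the function that is `0` on `[0, θ]` and `1 - θ / t` for
`t ≥ θ`. -/
noncomputable def cutoff (θ : ℝ) (c : B) : B := cfc (fun t : ℝ => 1 - θ * (max t θ)⁻¹) c

/-- The functional calculus of `c` for the function `t ↦ min (t / θ) 1`, which is a unit for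
`cutoff θ c`. -/
noncomputable def cutoffUnit (θ : ℝ) (c : B) : B := cfc (fun t : ℝ => t * (max t θ)⁻¹) c

lemma continuous_inv_max {θ : ℝ} (hθ : 0 < θ) : Continuous fun t : ℝ => (max t θ)⁻¹ :=
  (continuous_id.max continuous_const).inv₀ fun t => (lt_of_lt_of_le hθ (le_max_right t θ)).ne'

lemma mul_inv_max_le_one {θ : ℝ} (hθ : 0 < θ) (t : ℝ) : θ * (max t θ)⁻¹ ≤ 1 := by
  rw [← div_eq_mul_inv]
  exact div_le_one_of_le₀ (le_max_right _ _) (hθ.le.trans (le_max_right _ _))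

lemma mul_inv_max_le_one' {θ : ℝ} (hθ : 0 < θ) (t : ℝ) : t * (max t θ)⁻¹ ≤ 1 := by
  rw [← div_eq_mul_inv]
  exact div_le_one_of_le₀ (le_max_left _ _) (hθ.le.trans (le_max_right _ _))

lemma inv_max_nonneg {θ : ℝ} (hθ : 0 < θ) (t : ℝ) : 0 ≤ (max t θ)⁻¹ :=
  inv_nonneg.mpr (hθ.le.trans (le_max_right _ _))

variable {θ : ℝ} {c : B}

lemma cutoff_nonneg (hθ : 0 < θ) : 0 ≤ cutoff θ c :=
  cfc_nonneg fun t _ => by linarith [mul_inv_max_le_one hθ t]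

lemma cutoff_isSelfAdjoint (hθ : 0 < θ) : IsSelfAdjoint (cutoff θ c) :=
  .of_nonneg (cutoff_nonneg hθ)

lemma cutoff_le_one (hθ : 0 < θ) : cutoff θ c ≤ 1 :=
  cfc_le_one _ c fun t _ => by nlinarith [inv_max_nonneg hθ t]

lemma norm_cutoff_le_one (hθ : 0 < θ) : ‖cutoff θ c‖ ≤ 1 :=
  (CStarAlgebra.norm_le_one_iff_of_nonneg _ (cutoff_nonneg hθ)).mpr (cutoff_le_one hθ)

omit [PartialOrder B] [StarOrderedRing B] in
lemma Commute.cutoff_right {y : B} (hc : IsSelfAdjoint c) (h : Commute y c) (θ : ℝ) :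
    Commute y (cutoff θ c) :=
  (hc.commute_cfc h.symm _).symm

/-- The cutoff vanishes for t ≤ θ, and its unit equals 1 for t ≥ θ. -/
lemma one_sub_cutoffUnit_mul_cutoff (hθ : 0 < θ) (hc : 0 ≤ c) :
    (1 - cutoffUnit θ c) * cutoff θ c = 0 := by
  have hcont (s : Set ℝ) : ContinuousOn (fun t : ℝ => (max t θ)⁻¹) s :=
    (continuous_inv_max hθ).continuousOn
  have hsa : IsSelfAdjoint c := .of_nonneg hc
  have : (1 : B) - cutoffUnit θ c = cfc (fun t : ℝ => 1 - t * (max t θ)⁻¹) c := by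
    rw [cutoffUnit, one_sub_cfc hsa _ (by fun_prop)]
  rw [this, cutoff, ← cfc_mul _ _ c (by fun_prop) (by fun_prop)]
  refine (cfc_congr (g := fun _ => (0 : ℝ)) fun t _ => ?_).trans (cfc_const_zero ℝ c)
  rcases le_total t θ with h | h
  · simp [max_eq_right h, hθ.ne']
  · simp [max_eq_left h, (hθ.trans_le h).ne']

lemma cutoffUnit_nonneg (hθ : 0 < θ) (hc : 0 ≤ c) : 0 ≤ cutoffUnit θ c :=
  cfc_nonneg fun t ht => mul_nonneg (spectrum_nonneg_of_nonneg hc ht) (inv_max_nonneg hθ t)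

lemma cutoffUnit_le_one (hθ : 0 < θ) : cutoffUnit θ c ≤ 1 :=
  cfc_le_one _ c fun t _ => mul_inv_max_le_one' hθ t

lemma norm_one_sub_cutoffUnit_le_one (hθ : 0 < θ) (hc : 0 ≤ c) : ‖1 - cutoffUnit θ c‖ ≤ 1 :=
  (CStarAlgebra.norm_le_one_iff_of_nonneg _ (sub_nonneg.mpr (cutoffUnit_le_one hθ))).mpr
    (sub_le_self _ (cutoffUnit_nonneg hθ hc))

/-- The function min (t / θ) 1 is t times a function bounded by 1 / θ, so smallness of x * c is
inherited at the price of a factor 1 / θ. -/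
lemma norm_mul_cutoffUnit_le (hθ : 0 < θ) (hc : 0 ≤ c) (x : B) :
    ‖x * cutoffUnit θ c‖ ≤ ‖x * c‖ * θ⁻¹ := by
  have hcont (s : Set ℝ) : ContinuousOn (fun t : ℝ => (max t θ)⁻¹) s :=
    (continuous_inv_max hθ).continuousOn
  have : cutoffUnit θ c = c * cfc (fun t : ℝ => (max t θ)⁻¹) c := by
    nth_rewrite 2 [← cfc_id ℝ c]
    rw [← cfc_mul _ _ c (by fun_prop) (by fun_prop)]
    rfl
  rw [this, ← mul_assoc]
  refine (norm_mul_le _ _).trans ?_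
  gcongr
  refine norm_cfc_le (by positivity) fun t _ => ?_
  rw [Real.norm_of_nonneg (inv_max_nonneg hθ t)]
  exact inv_anti₀ hθ (le_max_right _ _)

lemma cutoff_mul_self_mul_cutoff_le (hθ : 0 < θ) (hc : 0 ≤ c) :
    cutoff θ c * c * cutoff θ c ≤ c := by
  have hcont (s : Set ℝ) : ContinuousOn (fun t : ℝ => (max t θ)⁻¹) s :=
    (continuous_inv_max hθ).continuousOn
  have hsa : IsSelfAdjoint c := .of_nonneg hc
  have e : cutoff θ c * c * cutoff θ c =
      cfc (fun t : ℝ => (1 - θ * (max t θ)⁻¹) * t * (1 - θ * (max t θ)⁻¹)) c := by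
    nth_rewrite 2 [← cfc_id ℝ c]
    rw [cutoff, ← cfc_mul _ _ c (by fun_prop) (by fun_prop),
      ← cfc_mul _ _ c (by fun_prop) (by fun_prop)]
    rfl
  rw [e]
  nth_rewrite 2 [← cfc_id ℝ c]
  refine cfc_mono (fun t ht => ?_) (by fun_prop) (by fun_prop)
  have ht0 := spectrum_nonneg_of_nonneg hc ht
  have h1 := mul_inv_max_le_one hθ t
  have h2 := mul_nonneg hθ.le (inv_max_nonneg hθ t)
  simp only [id]
  nlinarith [mul_nonneg ht0 h2, mul_nonneg (mul_nonneg ht0 h2) (sub_nonneg.mpr h1)]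

lemma norm_one_sub_cutoff_mul_self_mul_le (hθ : 0 < θ) (hc : 0 ≤ c) :
    ‖(1 - cutoff θ c) * c * (1 - cutoff θ c)‖ ≤ θ := by
  have hcont (s : Set ℝ) : ContinuousOn (fun t : ℝ => (max t θ)⁻¹) s :=
    (continuous_inv_max hθ).continuousOn
  have hsa : IsSelfAdjoint c := .of_nonneg hc
  have e1 : (1 : B) - cutoff θ c = cfc (fun t : ℝ => θ * (max t θ)⁻¹) c := by
    rw [cutoff, ← one_sub_cfc hsa (fun t : ℝ => θ * (max t θ)⁻¹) (by fun_prop), sub_sub_cancel]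
  have e : (1 - cutoff θ c) * c * (1 - cutoff θ c) =
      cfc (fun t : ℝ => (θ * (max t θ)⁻¹) * t * (θ * (max t θ)⁻¹)) c := by
    nth_rewrite 2 [← cfc_id ℝ c]
    rw [e1, ← cfc_mul _ _ c (by fun_prop) (by fun_prop),
      ← cfc_mul _ _ c (by fun_prop) (by fun_prop)]
    rfl
  rw [e]
  refine norm_cfc_le hθ.le fun t ht => ?_
  have ht0 := spectrum_nonneg_of_nonneg hc ht
  have h1 := mul_inv_max_le_one hθ t
  have h2 := mul_nonneg hθ.le (inv_max_nonneg hθ t)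
  have h3 := mul_inv_max_le_one' hθ t
  rw [Real.norm_of_nonneg (by positivity)]
  calc θ * (max t θ)⁻¹ * t * (θ * (max t θ)⁻¹) = θ * (t * (max t θ)⁻¹) * (θ * (max t θ)⁻¹) := by
        ring
    _ ≤ θ * 1 * 1 := by gcongr
    _ = θ := by ring

/-- A character evaluates the function at the point f c, which lies in [0, θ], where the function
vanishes. -/
lemma map_cutoff_eq_zero (hθ : 0 < θ) (hc : 0 ≤ c) (f : B →⋆ₐ[ℂ] ℂ) (h : f c ≤ θ) :
    f (cutoff θ c) = 0 := by
  have hcont (s : Set ℝ) : ContinuousOn (fun t : ℝ => (max t θ)⁻¹) s :=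
    (continuous_inv_max hθ).continuousOn
  have hsa : IsSelfAdjoint c := .of_nonneg hc
  have h0 : 0 ≤ f c := map_nonneg f hc
  obtain ⟨s, hs⟩ : ∃ s : ℝ, f c = s := ⟨(f c).re, (Complex.eq_re_of_ofReal_le h0).trans rfl⟩
  rw [hs] at h
  rw [cutoff, StarAlgHomClass.map_cfc (S := ℂ) f _ c (by fun_prop) (map_continuous f) hsa
    (hsa.map f), hs]
  have : ((s : ℝ) : ℂ) = algebraMap ℝ ℂ s := rfl
  rw [this, cfc_algebraMap, max_eq_right (by exact_mod_cast h), mul_inv_cancel₀ hθ.ne']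
  simp

end Cutoff

/-! ### Spectral projections in finite dimension -/

section SpectralProjection

variable {F : Type*} [CStarAlgebra F] [PartialOrder F] [StarOrderedRing F] [FiniteDimensional ℂ F]

omit [PartialOrder F] [StarOrderedRing F] in
lemma finite_real_spectrum (H : F) : (spectrum ℝ H).Finite := by
  rw [← spectrum.preimage_algebraMap ℂ]
  refine Set.Finite.preimage (FaithfulSMul.algebraMap_injective ℝ ℂ).injOn ?_
  have hint : IsIntegral ℂ H := Algebra.IsIntegral.isIntegral H
  refine ((minpoly ℂ H).rootSet ℂ).toFinite.subset fun z hz => ?_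
  rw [Polynomial.mem_rootSet]
  refine ⟨minpoly.ne_zero hint, ?_⟩
  have := spectrum.subset_polynomial_aeval H (minpoly ℂ H) ⟨z, hz, rfl⟩
  rw [minpoly.aeval] at this
  have hnt : Nontrivial F := by
    by_contra hn
    rw [not_nontrivial_iff_subsingleton] at hn
    simp at this
  rw [spectrum.zero_eq] at this
  simpa using this

/-- The spectrum is finite, so the indicator function of [η, ∞) is continuous on it. -/
lemma exists_spectral_projection {H : F} (hH : 0 ≤ H) {η : ℝ} (hη : 0 < η) :
    ∃ p : F, IsStarProjection p ∧ (η : ℂ) • p ≤ H ∧ ‖(1 - p) * H * (1 - p)‖ ≤ η := by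
  classical
  have hsa : IsSelfAdjoint H := .of_nonneg hH
  have hfin := finite_real_spectrum H
  have hc (f : ℝ → ℝ) : ContinuousOn f (spectrum ℝ H) := hfin.continuousOn f
  let f : ℝ → ℝ := fun t => if η ≤ t then 1 else 0
  refine ⟨cfc f H, ⟨?_, cfc_predicate _ _⟩, ?_, ?_⟩
  · rw [IsIdempotentElem, ← cfc_mul f f H (hc _) (hc _)]
    congr 1
    ext t
    by_cases h : η ≤ t <;> simp [f, h]
  · rw [Complex.coe_smul, ← cfc_smul η f H (hc _)]
    nth_rewrite 2 [← cfc_id ℝ H]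
    refine cfc_mono (fun t ht => ?_) (hc _) (hc _)
    have ht0 := spectrum_nonneg_of_nonneg hH ht
    by_cases h : η ≤ t <;> simp [f, h, ht0]
  · have e1 : (1 : F) - cfc f H = cfc (fun t : ℝ => 1 - f t) H := one_sub_cfc hsa f (hc _)
    have e : (1 - cfc f H) * H * (1 - cfc f H) =
        cfc (fun t : ℝ => (1 - f t) * t * (1 - f t)) H := by
      nth_rewrite 2 [← cfc_id ℝ H]
      rw [e1, ← cfc_mul _ _ H (hc _) (hc _), ← cfc_mul _ _ H (hc _) (hc _)]
      rfl
    rw [e]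
    refine norm_cfc_le hη.le fun t ht => ?_
    have ht0 := spectrum_nonneg_of_nonneg hH ht
    by_cases h : η ≤ t
    · simp [f, h, hη.le]
    · simp [f, h, abs_of_nonneg ht0, (not_le.mp h).le]

end SpectralProjection

/-! ### Decomposition into minimal projections -/

section MinimalProjections

variable {F : Type*} [Ring F] [StarRing F] [Algebra ℂ F] [FiniteDimensional ℂ F]

omit [Algebra ℂ F] [FiniteDimensional ℂ F] in
lemma IsStarProjection.mul_eq_right_of_mul_eq_left {p q : F} (hp : IsStarProjection p)
    (hq : IsStarProjection q) (h : p * q = q) : q * p = q := by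
  have := congrArg star h
  rwa [star_mul, hp.isSelfAdjoint.star_eq, hq.isSelfAdjoint.star_eq] at this

omit [Algebra ℂ F] [FiniteDimensional ℂ F] in
lemma IsStarProjection.sub_of_mul_eq {p q : F} (hp : IsStarProjection p)
    (hq : IsStarProjection q) (h : p * q = q) : IsStarProjection (p - q) := by
  refine ⟨?_, hp.isSelfAdjoint.sub hq.isSelfAdjoint⟩
  rw [IsIdempotentElem, sub_mul, mul_sub, mul_sub, h,
    hp.mul_eq_right_of_mul_eq_left hq h, hp.isIdempotentElem.eq, hq.isIdempotentElem.eq]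
  abel

/-- The dimension of the right ideal qF is the measure for splitting a projection into minimal ones.
-/
lemma finrank_range_mulLeft_lt {p q : F} (hp : IsStarProjection p)
    (hq : IsStarProjection q) (h : p * q = q) (hne : q ≠ p) :
    Module.finrank ℂ (LinearMap.range (LinearMap.mulLeft ℂ q)) <
      Module.finrank ℂ (LinearMap.range (LinearMap.mulLeft ℂ p)) := by
  apply Submodule.finrank_lt_finrank_of_lt
  refine lt_of_le_of_ne ?_ fun heq => hne ?_
  · rintro _ ⟨x, rfl⟩
    exact ⟨q * x, by simp [← mul_assoc, h]⟩
  · have : p ∈ LinearMap.range (LinearMap.mulLeft ℂ q) := by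
      rw [heq]; exact ⟨p, hp.isIdempotentElem⟩
    obtain ⟨y, hy⟩ := this
    rw [LinearMap.mulLeft_apply] at hy
    rw [← hp.mul_eq_right_of_mul_eq_left hq h]
    nth_rewrite 1 [← hy]
    rw [← mul_assoc, hq.isIdempotentElem.eq, hy]

/-- Every projection in a finite-dimensional star algebra is a sum of minimal ones below it. -/
lemma IsStarProjection.mem_of_forall_minimal_mem (S : AddSubmonoid F) {q : F}
    (hq : IsStarProjection q) (h : ∀ e, IsMinimalProjection e → q * e = e → e ∈ S) : q ∈ S := by
  induction hd : Module.finrank ℂ (LinearMap.range (LinearMap.mulLeft ℂ q)) using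
    Nat.strong_induction_on generalizing q with
  | _ d ih =>
    subst hd
    by_cases h0 : q = 0
    · rw [h0]; exact S.zero_mem
    by_cases hmin : IsMinimalProjection q
    · exact h q hmin hq.isIdempotentElem
    have : ∃ p : F, IsStarProjection p ∧ q * p = p ∧ p ≠ 0 ∧ p ≠ q := by
      by_contra hcon
      push Not at hcon
      exact hmin ⟨hq, h0, fun p hp hqp => or_iff_not_imp_left.mpr (hcon p hp hqp)⟩
    obtain ⟨p, hp, hqp, hp0, hpq⟩ := this
    have hp' := hq.sub_of_mul_eq hp hqp
    have hqp' : q * (q - p) = q - p := by rw [mul_sub, hq.isIdempotentElem.eq, hqp]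
    have hne' : q - p ≠ q := fun hh => hp0 (by simpa using hh)
    rw [← add_sub_cancel p q]
    refine S.add_mem (ih _ (finrank_range_mulLeft_lt hq hp hqp hpq) hp (fun e he hpe => ?_) rfl)
      (ih _ (finrank_range_mulLeft_lt hq hp' hqp' hne') hp' (fun e he hpe => ?_) rfl)
    · exact h e he (by rw [← hpe, ← mul_assoc, hqp])
    · exact h e he (by rw [← hpe, ← mul_assoc, hqp'])

end MinimalProjections

/-! ### Blocks of a sum of matrix algebras -/

section Blocks

variable {ι : Type} {r : ι → ℕ}

instance [Fintype ι] (r : ι → ℕ) : FiniteDimensional ℂ (MatrixSum r) :=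
  inferInstanceAs (FiniteDimensional ℂ (∀ i, Matrix (Fin (r i)) (Fin (r i)) ℂ))

open Classical in
/-- The central projection of `MatrixSum r` onto the blocks satisfying `P`. -/
noncomputable def blockProj (r : ι → ℕ) (P : ι → Prop) : MatrixSum r := fun i => if P i then 1 else 0

open Classical in
lemma blockProj_mul_apply (P : ι → Prop) (x : MatrixSum r) (i : ι) :
    (blockProj r P * x) i = if P i then x i else 0 := by
  by_cases h : P i <;> simp [blockProj, h]

lemma blockProj_comm (P : ι → Prop) (x : MatrixSum r) :
    blockProj r P * x = x * blockProj r P := by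
  funext i
  by_cases h : P i <;> simp [blockProj, h]

lemma isStarProjection_blockProj (P : ι → Prop) : IsStarProjection (blockProj r P) := by
  constructor
  · funext i
    by_cases h : P i <;> simp [blockProj, h]
  · funext i
    by_cases h : P i <;> simp [blockProj, h]

lemma blockProj_mul_blockProj_of_disjoint {P Q : ι → Prop} (h : ∀ i, P i → ¬ Q i) :
    blockProj r P * blockProj r Q = 0 := by
  funext i
  rw [blockProj_mul_apply]
  by_cases hP : P i
  · simp [blockProj, hP, h i hP]
  · simp [hP]

lemma sum_blockProj {κ : Type*} [Fintype κ] (c : ι → κ) :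
    ∑ j, blockProj r (fun i => c i = j) = 1 := by
  classical
  funext i
  rw [Finset.sum_apply, Finset.sum_eq_single (c i)]
  · simp [blockProj]
  · intro j _ hj
    simp [blockProj, hj.symm]
  · simp

/-- Restriction to the blocks in `I`. -/
def MatrixSum.restrict (I : Set ι) (x : MatrixSum r) : MatrixSum (fun i : I => r i) := fun i => x i

lemma MatrixSum.incl_restrict {I : Set ι} {x : MatrixSum r}
    (h : blockProj r (· ∈ I) * x = x) : MatrixSum.incl r I (MatrixSum.restrict I x) = x := by
  classical
  funext i
  rw [← h, blockProj_mul_apply]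
  by_cases hi : i ∈ I
  · simp [MatrixSum.incl, MatrixSum.restrict, hi, blockProj]
  · simp [MatrixSum.incl, hi]

lemma MatrixSum.blockProj_mul_incl (I : Set ι) (x : MatrixSum (fun i : I => r i)) :
    blockProj r (· ∈ I) * MatrixSum.incl r I x = MatrixSum.incl r I x := by
  funext i
  rw [blockProj_mul_apply]
  by_cases hi : i ∈ I <;> simp [MatrixSum.incl, hi]

lemma MatrixSum.incl_mul (I : Set ι) (x y : MatrixSum (fun i : I => r i)) :
    MatrixSum.incl r I (x * y) = MatrixSum.incl r I x * MatrixSum.incl r I y := by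
  funext i
  by_cases hi : i ∈ I <;> simp [MatrixSum.incl, hi]

lemma MatrixSum.incl_star (I : Set ι) (x : MatrixSum (fun i : I => r i)) :
    MatrixSum.incl r I (star x) = star (MatrixSum.incl r I x) := by
  funext i
  by_cases hi : i ∈ I <;> simp [MatrixSum.incl, hi]

lemma MatrixSum.isStarProjection_incl {I : Set ι} {x : MatrixSum (fun i : I => r i)}
    (h : IsStarProjection x) : IsStarProjection (MatrixSum.incl r I x) := by
  refine ⟨?_, ?_⟩
  · rw [IsIdempotentElem, ← MatrixSum.incl_mul, h.isIdempotentElem.eq]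
  · rw [IsSelfAdjoint, ← MatrixSum.incl_star, h.isSelfAdjoint.star_eq]

lemma MatrixSum.isStarProjection_restrict (I : Set ι) {x : MatrixSum r}
    (h : IsStarProjection x) : IsStarProjection (MatrixSum.restrict I x) := by
  refine ⟨?_, ?_⟩
  · funext i; exact congrFun h.isIdempotentElem i
  · funext i; exact congrFun h.isSelfAdjoint i

end Blocks

/-! ### Order zero, colour by colour -/

section Decomposable

variable {A : Type*} [NonUnitalCStarAlgebra A] [PartialOrder A] [StarOrderedRing A]
  {ι : Type} [Fintype ι] {r : ι → ℕ} {n : ℕ}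

/-- `φ` maps orthogonal projections of the same colour (below `p`) to orthogonal elements. -/
def OrthogonalOnColors (c : ι → Fin (n + 1)) (p : MatrixSum r) (φ : MatrixSum r →ₗ[ℂ] A) : Prop :=
  ∀ (j : Fin (n + 1)) (e f : MatrixSum r), IsStarProjection e → IsStarProjection f →
    p * e = e → p * f = f →
    blockProj r (fun i => c i = j) * e = e → blockProj r (fun i => c i = j) * f = f →
    e * f = 0 → φ e * φ f = 0

omit [PartialOrder A] [StarOrderedRing A] in
lemma mul_eq_zero_symm_of_isSelfAdjoint {a b : A} (ha : IsSelfAdjoint a) (hb : IsSelfAdjoint b)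
    (h : a * b = 0) : b * a = 0 := by
  have := congrArg star h
  rwa [star_mul, ha.star_eq, hb.star_eq, star_zero] at this

lemma IsCompletelyPositive.isSelfAdjoint_apply {F : Type*} [NonUnitalCStarAlgebra F]
    [PartialOrder F] [StarOrderedRing F] {φ : F →ₗ[ℂ] A} (hφ : IsCompletelyPositive φ) {e : F}
    (he : IsStarProjection e) : IsSelfAdjoint (φ e) :=
  .of_nonneg (hφ.nonneg he.nonneg)

/-- For a fixed other factor, orthogonality of the images is an additive condition, so it passes
from minimal projections to their sums, in one variable at a time. -/
lemma IsDecomposable.exists_orthogonalOnColors {φ : MatrixSum r →CP A} (h : IsDecomposable n φ) :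
    ∃ c : ι → Fin (n + 1), OrthogonalOnColors c 1 φ.toLinearMap := by
  obtain ⟨c, hc⟩ := h
  refine ⟨c, fun j e f he hf _ _ hje hjf hef => ?_⟩
  have hφ := φ.isCompletelyPositive
  set I : Set ι := {i | c i = j}
  set θ := φ.toLinearMap ∘ₗ MatrixSum.incl r I with hθ
  have hsa {x : MatrixSum (fun i : I => r i)} (hx : IsStarProjection x) :
      IsSelfAdjoint (θ x) := hφ.isSelfAdjoint_apply (MatrixSum.isStarProjection_incl hx)
  have hmin (x y) (hx : IsMinimalProjection x) (hy : IsMinimalProjection y) (hxy : x * y = 0) :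
      θ x * θ y = 0 := by
    have hyx : y * x = 0 := by
      have := congrArg star hxy
      rwa [star_mul, hx.1.isSelfAdjoint.star_eq, hy.1.isSelfAdjoint.star_eq, star_zero] at this
    obtain ⟨k, l, hkl, h0⟩ := hc j ![x, y] (by intro k; fin_cases k <;> simpa)
      (by intro k l hkl; fin_cases k <;> fin_cases l <;> simp_all)
    -- Strict order zero does not say in which order the product vanishes; taking adjoints settles
    -- the other case.
    fin_cases k <;> fin_cases l
    · exact absurd rfl hkl
    · exact h0
    · exact mul_eq_zero_symm_of_isSelfAdjoint (hsa hy.1) (hsa hx.1) h0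
    · exact absurd rfl hkl
  have hI (x : MatrixSum r) (hx : blockProj r (fun i => c i = j) * x = x) :
      MatrixSum.incl r I (MatrixSum.restrict I x) = x := MatrixSum.incl_restrict hx
  have he' := MatrixSum.isStarProjection_restrict I he
  have hf' := MatrixSum.isStarProjection_restrict I hf
  have hef' : MatrixSum.restrict I e * MatrixSum.restrict I f = 0 := by
    funext i; exact congrFun hef i
  have key : θ (MatrixSum.restrict I e) * θ (MatrixSum.restrict I f) = 0 := by
    let S : AddSubmonoid (MatrixSum (fun i : I => r i)) :=
      { carrier := {x | θ x * θ (MatrixSum.restrict I f) = 0}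
        zero_mem' := by simp
        add_mem' := fun {a b} ha hb => by
          change _ = 0 at ha hb
          change _ = 0
          rw [map_add, add_mul, ha, hb, add_zero] }
    refine he'.mem_of_forall_minimal_mem S fun x hx hex => ?_
    let S' : AddSubmonoid (MatrixSum (fun i : I => r i)) :=
      { carrier := {y | θ x * θ y = 0}
        zero_mem' := by simp
        add_mem' := fun {a b} ha hb => by
          change _ = 0 at ha hb
          change _ = 0
          rw [map_add, mul_add, ha, hb, add_zero] }
    refine hf'.mem_of_forall_minimal_mem S' fun y hy hfy => hmin x y hx hy ?_
    -- Since x = xe and y = fy, the product xy = x(ef)y is zero.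
    rw [← he'.mul_eq_right_of_mul_eq_left hx.1 hex, ← hfy, mul_assoc, ← mul_assoc _ _ y, hef',
      zero_mul, mul_zero]
  rw [hθ, LinearMap.comp_apply, LinearMap.comp_apply, hI e hje, hI f hjf] at key
  exact key

lemma OrthogonalOnColors.isDecomposable {φ : MatrixSum r →CP A} {c : ι → Fin (n + 1)}
    (h : OrthogonalOnColors c 1 φ.toLinearMap) : IsDecomposable n φ := by
  refine ⟨c, fun j e he heq => ⟨0, 1, by simp, ?_⟩⟩
  refine h j _ _ (MatrixSum.isStarProjection_incl (he 0).1)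
    (MatrixSum.isStarProjection_incl (he 1).1) (one_mul _) (one_mul _)
    (MatrixSum.blockProj_mul_incl _ _) (MatrixSum.blockProj_mul_incl _ _) ?_
  rw [← MatrixSum.incl_mul, heq 0 1 (by simp), map_zero]

end Decomposable

/-! ### Corners of matrix sums -/

section Compression

open scoped Matrix

/-- The eigenvalues are 0 or 1; the columns of v are the eigenvectors for the eigenvalue 1. -/
lemma Matrix.exists_isometry_of_isStarProjection {m : ℕ} {P : Matrix (Fin m) (Fin m) ℂ}
    (hP : IsStarProjection P) :
    ∃ (d : ℕ) (v : Matrix (Fin m) (Fin d) ℂ), vᴴ * v = 1 ∧ v * vᴴ = P := by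
  classical
  have hH : P.IsHermitian := hP.isSelfAdjoint
  set U : Matrix (Fin m) (Fin m) ℂ := hH.eigenvectorUnitary.1 with hU
  have hU1 : Uᴴ * U = 1 := Unitary.coe_star_mul_self hH.eigenvectorUnitary
  set ev := hH.eigenvalues
  have hsp : P = U * Matrix.diagonal (fun i => (ev i : ℂ)) * Uᴴ := hH.spectral_theorem
  have hdiag : Matrix.diagonal (fun i => (ev i : ℂ)) = Uᴴ * P * U := by
    rw [hsp]
    simp only [Matrix.mul_assoc, hU1, Matrix.mul_one]
    rw [← Matrix.mul_assoc, hU1, Matrix.one_mul]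
  have hU2 : U * Uᴴ = 1 := Unitary.coe_mul_star_self hH.eigenvectorUnitary
  have hid : Matrix.diagonal (fun i => (ev i : ℂ) * (ev i : ℂ)) =
      Matrix.diagonal (fun i => (ev i : ℂ)) := by
    rw [← Matrix.diagonal_mul_diagonal, hdiag]
    calc Uᴴ * P * U * (Uᴴ * P * U) = Uᴴ * P * (U * Uᴴ) * P * U := by
          simp only [Matrix.mul_assoc]
      _ = Uᴴ * (P * P) * U := by rw [hU2]; simp only [Matrix.mul_assoc, Matrix.mul_one]
      _ = _ := by rw [hP.isIdempotentElem.eq]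
  have hev (i : Fin m) : (ev i : ℂ) = if ev i = 1 then 1 else 0 := by
    have h1 := congrFun (Matrix.diagonal_injective hid) i
    have h2 : ev i * ev i = ev i := by exact_mod_cast h1
    by_cases h : ev i = 1
    · simp [h]
    · have : ev i = 0 := by
        rcases mul_eq_zero.mp (show ev i * (ev i - 1) = 0 by linarith) with h0 | h0
        · exact h0
        · exact absurd (by linarith) h
      simp [this]
  let T := {i : Fin m // ev i = 1}
  let g : Fin (Fintype.card T) ≃ T := (Fintype.equivFin T).symm
  refine ⟨Fintype.card T, U.submatrix id (fun k => (g k : Fin m)), ?_, ?_⟩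
  · ext k l
    have := congrFun (congrFun hU1 (g k)) (g l)
    simp only [Matrix.mul_apply, Matrix.conjTranspose_apply, Matrix.submatrix_apply, id,
      Matrix.one_apply] at this ⊢
    rw [this]
    simp [Subtype.ext_iff.symm]
  · rw [hsp]
    ext k l
    have hterm (i : Fin m) : U k i * (ev i : ℂ) * star (U l i) =
        if ev i = 1 then U k i * star (U l i) else 0 := by
      rw [hev i]
      split_ifs <;> simp
    change ∑ x, U k (g x : Fin m) * star (U l (g x : Fin m)) =
      ∑ i, (U * Matrix.diagonal (fun i => (ev i : ℂ))) k i * star (U l i)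
    calc ∑ x, U k (g x : Fin m) * star (U l (g x : Fin m))
        = ∑ t : T, U k (t : Fin m) * star (U l (t : Fin m)) :=
          Equiv.sum_comp g (fun t : T => U k (t : Fin m) * star (U l (t : Fin m)))
      _ = ∑ i with ev i = 1, U k i * star (U l i) :=
          (Finset.sum_subtype _ (by simp) (fun i => U k i * star (U l i))).symm
      _ = ∑ i, U k i * (ev i : ℂ) * star (U l i) := by
          rw [Finset.sum_filter]
          exact Finset.sum_congr rfl fun i _ => (hterm i).symm
      _ = _ := by
          refine Finset.sum_congr rfl fun i _ => ?_
          congr 1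
          exact (Matrix.mul_diagonal (fun i => (ev i : ℂ)) U k i).symm

variable {ι : Type} {r : ι → ℕ}

/-- The corner of `MatrixSum r` at a projection is again a direct sum of matrix algebras. -/
lemma MatrixSum.exists_corner {p : MatrixSum r} (hp : IsStarProjection p) :
    ∃ (d : ι → ℕ) (j : MatrixSum d →⋆ₙₐ[ℂ] MatrixSum r) (κ : MatrixSum r →ₗ[ℂ] MatrixSum d),
      Function.Injective j ∧ (∀ x, j (κ x) = p * x * p) ∧ (∀ x, p * j x = j x) ∧
      ∀ (P : ι → Prop) x, j (blockProj d P * x) = blockProj r P * j x := by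
  have h1 (i : ι) : ∃ (d : ℕ) (v : Matrix (Fin (r i)) (Fin d) ℂ), vᴴ * v = 1 ∧
      v * vᴴ = CStarMatrix.ofMatrix.symm (p i) :=
    Matrix.exists_isometry_of_isStarProjection
      ⟨congrFun hp.isIdempotentElem i, congrFun hp.isSelfAdjoint i⟩
  choose d v hv1 hv2 using h1
  -- The relation v*v = 1 makes j multiplicative and injective; vv* = p makes j ∘ κ the compression
  -- by p.
  let j : MatrixSum d →⋆ₙₐ[ℂ] MatrixSum r :=
    { toFun := fun x i =>
        CStarMatrix.ofMatrix (v i * CStarMatrix.ofMatrix.symm (x i) * (v i)ᴴ)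
      map_smul' := fun t x => by
        funext i
        change v i * (t • CStarMatrix.ofMatrix.symm (x i)) * (v i)ᴴ =
          t • (v i * CStarMatrix.ofMatrix.symm (x i) * (v i)ᴴ)
        rw [Matrix.mul_smul, Matrix.smul_mul]
      map_zero' := by
        funext i
        change v i * (0 : Matrix (Fin (d i)) (Fin (d i)) ℂ) * (v i)ᴴ = 0
        rw [Matrix.mul_zero, Matrix.zero_mul]
      map_add' := fun x y => by
        funext i
        change v i * (CStarMatrix.ofMatrix.symm (x i) + CStarMatrix.ofMatrix.symm (y i)) * (v i)ᴴ =
          v i * CStarMatrix.ofMatrix.symm (x i) * (v i)ᴴ +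
            v i * CStarMatrix.ofMatrix.symm (y i) * (v i)ᴴ
        rw [Matrix.mul_add, Matrix.add_mul]
      map_mul' := fun x y => by
        funext i
        change v i * (CStarMatrix.ofMatrix.symm (x i) * CStarMatrix.ofMatrix.symm (y i)) * (v i)ᴴ =
          (v i * CStarMatrix.ofMatrix.symm (x i) * (v i)ᴴ) *
            (v i * CStarMatrix.ofMatrix.symm (y i) * (v i)ᴴ)
        calc _ = v i * CStarMatrix.ofMatrix.symm (x i) * (1 : Matrix (Fin (d i)) (Fin (d i)) ℂ) *
              CStarMatrix.ofMatrix.symm (y i) * (v i)ᴴ := by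
              simp only [Matrix.mul_assoc, Matrix.mul_one]
          _ = _ := by rw [← hv1]; simp only [Matrix.mul_assoc]
      map_star' := fun x => by
        funext i
        change v i * (CStarMatrix.ofMatrix.symm (x i))ᴴ * (v i)ᴴ =
          (v i * CStarMatrix.ofMatrix.symm (x i) * (v i)ᴴ)ᴴ
        simp only [Matrix.conjTranspose_mul, Matrix.conjTranspose_conjTranspose,
          Matrix.mul_assoc] }
  let κ : MatrixSum r →ₗ[ℂ] MatrixSum d :=
    { toFun := fun x i =>
        CStarMatrix.ofMatrix ((v i)ᴴ * CStarMatrix.ofMatrix.symm (x i) * v i)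
      map_smul' := fun t x => by
        funext i
        change (v i)ᴴ * (t • CStarMatrix.ofMatrix.symm (x i)) * v i =
          t • ((v i)ᴴ * CStarMatrix.ofMatrix.symm (x i) * v i)
        rw [Matrix.mul_smul, Matrix.smul_mul]
      map_add' := fun x y => by
        funext i
        change (v i)ᴴ * (CStarMatrix.ofMatrix.symm (x i) + CStarMatrix.ofMatrix.symm (y i)) * v i =
          (v i)ᴴ * CStarMatrix.ofMatrix.symm (x i) * v i +
            (v i)ᴴ * CStarMatrix.ofMatrix.symm (y i) * v i
        rw [Matrix.mul_add, Matrix.add_mul] }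
  refine ⟨d, j, κ, ?_, fun x => ?_, fun x => ?_, fun P x => ?_⟩
  · intro x y hxy
    funext i
    have h2 : v i * CStarMatrix.ofMatrix.symm (x i) * (v i)ᴴ =
      v i * CStarMatrix.ofMatrix.symm (y i) * (v i)ᴴ := congrFun hxy i
    have h3 (z : Matrix (Fin (d i)) (Fin (d i)) ℂ) :
        (v i)ᴴ * (v i * z * (v i)ᴴ) * v i = z := by
      calc _ = ((v i)ᴴ * v i) * z * ((v i)ᴴ * v i) := by simp only [Matrix.mul_assoc]
        _ = z := by rw [hv1, Matrix.one_mul, Matrix.mul_one]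
    have h4 := congrArg (fun z => (v i)ᴴ * z * v i) h2
    simp only [h3] at h4
    exact h4
  · funext i
    change v i * ((v i)ᴴ * CStarMatrix.ofMatrix.symm (x i) * v i) * (v i)ᴴ =
      CStarMatrix.ofMatrix.symm (p i) * CStarMatrix.ofMatrix.symm (x i) *
        CStarMatrix.ofMatrix.symm (p i)
    rw [← hv2]
    simp only [Matrix.mul_assoc]
  · funext i
    change CStarMatrix.ofMatrix.symm (p i) * (v i * CStarMatrix.ofMatrix.symm (x i) * (v i)ᴴ) =
      v i * CStarMatrix.ofMatrix.symm (x i) * (v i)ᴴ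
    rw [← hv2]
    calc _ = v i * ((v i)ᴴ * v i) * CStarMatrix.ofMatrix.symm (x i) * (v i)ᴴ := by
          simp only [Matrix.mul_assoc]
      _ = _ := by rw [hv1, Matrix.mul_one]
  · funext i
    rw [blockProj_mul_apply]
    by_cases h : P i
    · rw [if_pos h]
      change v i * CStarMatrix.ofMatrix.symm ((blockProj d P * x) i) * (v i)ᴴ = _
      rw [blockProj_mul_apply, if_pos h]
      rfl
    · rw [if_neg h]
      change v i * CStarMatrix.ofMatrix.symm ((blockProj d P * x) i) * (v i)ᴴ = 0
      rw [blockProj_mul_apply, if_neg h]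
      change v i * (0 : Matrix (Fin (d i)) (Fin (d i)) ℂ) * (v i)ᴴ = 0
      rw [Matrix.mul_zero, Matrix.zero_mul]

end Compression

/-! ### Adding a one-dimensional block -/

section AdjoinBlock

/-- The new block has index 0. Coordinate homomorphisms carry all the information, so that later
arguments avoid the dependent type of the enlarged family. -/
lemma MatrixSum.exists_adjoin_block {s : ℕ} (r : Fin s → ℕ) :
    ∃ (r' : Fin (s + 1) → ℕ) (π₀ : MatrixSum r' →⋆ₙₐ[ℂ] ℂ) (π₁ : MatrixSum r' →⋆ₙₐ[ℂ] MatrixSum r)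
      (ι₀ : ℂ →⋆ₙₐ[ℂ] MatrixSum r') (ι₁ : MatrixSum r →⋆ₙₐ[ℂ] MatrixSum r'),
      (∀ z, π₀ (ι₀ z) = z) ∧ (∀ z, π₁ (ι₀ z) = 0) ∧ (∀ x, π₀ (ι₁ x) = 0) ∧ (∀ x, π₁ (ι₁ x) = x) ∧
      π₀ 1 = 1 ∧ π₁ 1 = 1 ∧ (∀ x y, π₀ x = π₀ y → π₁ x = π₁ y → x = y) ∧
      (∀ (P : Fin (s + 1) → Prop) x,
        π₁ (blockProj r' P * x) = blockProj r (fun i => P i.succ) * π₁ x) ∧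
      ∀ (P : Fin (s + 1) → Prop) x, ¬ P 0 → π₀ (blockProj r' P * x) = 0 := by
  let r' : Fin (s + 1) → ℕ := Fin.cons 1 r
  let e : CStarMatrix (Fin 1) (Fin 1) ℂ →⋆ₙₐ[ℂ] ℂ :=
    { toFun := fun M => M 0 0
      map_smul' := fun t M => rfl
      map_zero' := rfl
      map_add' := fun M N => rfl
      map_mul' := fun M N => by simp [CStarMatrix.mul_apply]
      map_star' := fun M => rfl }
  let at₀ (x : MatrixSum r') : CStarMatrix (Fin 1) (Fin 1) ℂ := x 0
  let π₀ : MatrixSum r' →⋆ₙₐ[ℂ] ℂ :=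
    { toFun := fun x => e (at₀ x)
      map_smul' := fun t x => map_smul e t (at₀ x)
      map_zero' := map_zero e
      map_add' := fun x y => map_add e (at₀ x) (at₀ y)
      map_mul' := fun x y => map_mul e (at₀ x) (at₀ y)
      map_star' := fun x => map_star e (at₀ x) }
  let π₁ : MatrixSum r' →⋆ₙₐ[ℂ] MatrixSum r :=
    { toFun := fun x i => x i.succ
      map_smul' := fun t x => rfl
      map_zero' := rfl
      map_add' := fun x y => rfl
      map_mul' := fun x y => rfl
      map_star' := fun x => rfl }
  let mk (z : ℂ) (x : MatrixSum r) : MatrixSum r' := fun i =>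
    Fin.cases (motive := fun i => CStarMatrix (Fin (r' i)) (Fin (r' i)) ℂ) (fun _ _ => z) (fun i => x i) i
  have mk0 (z x) : π₀ (mk z x) = z := rfl
  have mk1 (z x) : π₁ (mk z x) = x := rfl
  have hext (x y : MatrixSum r') (h0 : π₀ x = π₀ y) (h1 : π₁ x = π₁ y) : x = y := by
    funext i
    refine Fin.cases ?_ (fun i => ?_) i
    · change at₀ x = at₀ y
      ext k l
      rw [Subsingleton.elim k 0, Subsingleton.elim l 0]
      exact h0
    · exact congrFun h1 i
  let ι₀ : ℂ →⋆ₙₐ[ℂ] MatrixSum r' :=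
    { toFun := fun z => mk z 0
      map_smul' := fun t x => hext _ _ (by simp only [map_smul, mk0]; rfl)
        (by simp only [map_smul, mk1, smul_zero])
      map_zero' := hext _ _ (by simp only [map_zero, mk0]) (by simp only [map_zero, mk1])
      map_add' := fun x y => hext _ _ (by simp only [map_add, mk0])
        (by simp only [map_add, mk1, add_zero])
      map_mul' := fun x y => hext _ _ (by simp only [map_mul, mk0])
        (by simp only [map_mul, mk1, mul_zero])
      map_star' := fun x => hext _ _ (by simp only [map_star, mk0])
        (by simp only [map_star, mk1, star_zero]) }
  let ι₁ : MatrixSum r →⋆ₙₐ[ℂ] MatrixSum r' :=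
    { toFun := fun x => mk 0 x
      map_smul' := fun t x => hext _ _ (by simp only [map_smul, mk0, smul_zero])
        (by simp only [map_smul, mk1]; rfl)
      map_zero' := hext _ _ (by simp only [map_zero, mk0]) (by simp only [map_zero, mk1])
      map_add' := fun x y => hext _ _ (by simp only [map_add, mk0, add_zero])
        (by simp only [map_add, mk1])
      map_mul' := fun x y => hext _ _ (by simp only [map_mul, mk0, mul_zero])
        (by simp only [map_mul, mk1])
      map_star' := fun x => hext _ _ (by simp only [map_star, mk0, star_zero])
        (by simp only [map_star, mk1]) }
  refine ⟨r', π₀, π₁, ι₀, ι₁, fun z => mk0 z 0, fun z => mk1 z 0, fun x => mk0 0 x,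
    fun x => mk1 0 x, rfl, rfl, hext, fun P x => ?_, fun P x hP => ?_⟩
  · funext i
    rw [blockProj_mul_apply]
    change (blockProj r' P * x) i.succ = _
    rw [blockProj_mul_apply]
    rfl
  · have : at₀ (blockProj r' P * x) = 0 := by
      change (blockProj r' P * x) 0 = 0
      rw [blockProj_mul_apply, if_neg hP]
    change e (at₀ (blockProj r' P * x)) = 0
    rw [this, map_zero]

end AdjoinBlock

/-! ### A flexible criterion for bounding the decomposition rank -/

section Criterion

variable {A : Type*} [NonUnitalCStarAlgebra A] [PartialOrder A] [StarOrderedRing A] {n : ℕ}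

/-- The set T and the constant M depend on b only, so they can be fixed before the approximation L
is chosen. -/
lemma exists_finset_norm_sub_le_of_mem_span {E : Type*} [SeminormedAddCommGroup E] [NormedSpace ℂ E]
    {S : Set E} {b : E} (hb : b ∈ Submodule.span ℂ S) :
    ∃ (T : Finset E) (M : ℝ), ↑T ⊆ S ∧ 0 ≤ M ∧ ∀ (L : E →ₗ[ℂ] E) (δ : ℝ),
      (∀ t ∈ T, ‖L t - t‖ ≤ δ) → 0 ≤ δ → ‖L b - b‖ ≤ M * δ := by
  classical
  induction hb using Submodule.span_induction with
  | mem x hx =>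
    exact ⟨{x}, 1, by simpa, zero_le_one, fun L δ h _ => by simpa using h x⟩
  | zero => exact ⟨∅, 0, by simp, le_rfl, fun L δ _ _ => by simp⟩
  | add x y _ _ hx hy =>
    obtain ⟨T, M, hT, hM, h⟩ := hx
    obtain ⟨T', M', hT', hM', h'⟩ := hy
    refine ⟨T ∪ T', M + M', by simp [hT, hT'], by positivity, fun L δ hL hδ => ?_⟩
    have h1 := h L δ (fun t ht => hL t (Finset.mem_union_left _ ht)) hδ
    have h2 := h' L δ (fun t ht => hL t (Finset.mem_union_right _ ht)) hδ
    rw [map_add, add_sub_add_comm, add_mul]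
    exact (norm_add_le _ _).trans (add_le_add h1 h2)
  | smul z x _ hx =>
    obtain ⟨T, M, hT, hM, h⟩ := hx
    refine ⟨T, ‖z‖ * M, hT, by positivity, fun L δ hL hδ => ?_⟩
    rw [map_smul, ← smul_sub, norm_smul, mul_assoc]
    gcongr
    exact h L δ hL hδ

/-- To bound the decomposition rank it suffices to approximate a spanning set, to control `φ` only
on the corner at a projection `p`, and to have `φ` almost contractive there. -/
lemma decompositionRankLE_of_approx {S : Set A} (hS : Submodule.span ℂ S = ⊤)
    (h : ∀ T : Finset A, ↑T ⊆ S → ∀ ε : ℝ, 0 < ε → ε ≤ 1 →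
      ∃ (s : ℕ) (r : Fin s → ℕ) (ψ : A →ₗ[ℂ] MatrixSum r) (φ : MatrixSum r →ₗ[ℂ] A)
        (p : MatrixSum r) (c : Fin s → Fin (n + 1)),
        IsCompletelyPositive ψ ∧ IsCompletelyPositive φ ∧ IsStarProjection p ∧
        (∀ a, ‖ψ a‖ ≤ ‖a‖) ∧ (∀ x, ‖φ (p * x * p)‖ ≤ (1 + ε) * ‖x‖) ∧
        (∀ b ∈ T, ‖φ (p * ψ b * p) - b‖ ≤ ε) ∧ OrthogonalOnColors c p φ) :
    DecompositionRankLE A n := by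
  classical
  intro m b ε hε
  have hb (k : Fin m) := exists_finset_norm_sub_le_of_mem_span (S := S) (b := b k)
    (by rw [hS]; trivial)
  choose T M hTS hM hTM using hb
  set T' : Finset A := Finset.univ.biUnion T
  set R : ℝ := ∑ t ∈ T', ‖t‖
  have hR : 0 ≤ R := Finset.sum_nonneg fun t _ => norm_nonneg t
  set M' : ℝ := ∑ k, M k
  have hM' : 0 ≤ M' := Finset.sum_nonneg fun k _ => hM k
  -- Rescaling φ by 1 / (1 + δ) gives error at most δ(1 + R) on T'; passing to the span multiplies
  -- it by at most M'. The extra 1 in M' + 1 makes the final inequality strict.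
  set δ : ℝ := min 1 (ε / ((M' + 1) * (1 + R)))
  have hδ : 0 < δ := lt_min one_pos (by positivity)
  have hδε : M' * (δ * (1 + R)) < ε := by
    have h1 : δ * ((M' + 1) * (1 + R)) ≤ ε := by
      rw [← le_div_iff₀ (by positivity)]; exact min_le_right _ _
    have h2 : 0 < δ * (1 + R) := by positivity
    nlinarith
  obtain ⟨s, r, ψ, φ, p, c, hψ, hφ, hp, hψ1, hφ1, hap, horth⟩ :=
    h T' (by simp [T', hTS]) δ hδ (min_le_left _ _)
  obtain ⟨d, j, κ, hj, hjκ, hpj, hjP⟩ := MatrixSum.exists_corner hp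
  have hjn (x) : ‖j x‖ = ‖x‖ := NonUnitalStarAlgHom.norm_map j hj x
  have hjp (x) : p * j x * p = j x := by
    rw [hpj]
    have := congrArg star (hpj (star x))
    rwa [star_mul, map_star, star_star, hp.isSelfAdjoint.star_eq] at this
  have hpn : ‖p‖ ≤ 1 := hp.norm_le
  -- After the embedding j this map becomes ψ compressed by p.
  have hψ' : IsCompletelyPositive (κ ∘ₗ ψ) := by
    refine .of_comp_injective j hj ?_
    have : (j : MatrixSum d →ₗ[ℂ] MatrixSum r) ∘ₗ κ ∘ₗ ψ = conjugation p ∘ₗ ψ := by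
      ext1 x
      simp only [LinearMap.comp_apply, conjugation_apply, hp.isSelfAdjoint.star_eq]
      exact hjκ (ψ x)
    rw [this]
    exact (IsCompletelyPositive.conjugation p).comp hψ
  have hφ' := (hφ.comp (IsCompletelyPositive.starHom j)).smul (t := (1 + δ)⁻¹) (by positivity)
  refine ⟨s, d, hψ'.toCP, hφ'.toCP, fun a => ?_, fun x => ?_, fun k => ?_, ?_⟩
  · change ‖κ (ψ a)‖ ≤ ‖a‖
    rw [← hjn, hjκ]
    calc ‖p * ψ a * p‖ ≤ ‖p‖ * ‖ψ a‖ * ‖p‖ :=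
          (norm_mul_le _ _).trans (by gcongr; exact norm_mul_le _ _)
      _ ≤ 1 * ‖a‖ * 1 := by gcongr; exact hψ1 a
      _ = ‖a‖ := by ring
  · change ‖(((1 + δ)⁻¹ : ℝ) : ℂ) • φ (j x)‖ ≤ ‖x‖
    rw [norm_smul, Complex.norm_real, Real.norm_of_nonneg (by positivity),
      inv_mul_le_iff₀ (by positivity), ← hjp, ← hjn x]
    exact hφ1 (j x)
  · change ‖(((1 + δ)⁻¹ : ℝ) : ℂ) • φ (j (κ (ψ (b k)))) - b k‖ < ε
    let L : A →ₗ[ℂ] A := (((1 + δ)⁻¹ : ℝ) : ℂ) • (φ ∘ₗ (j : MatrixSum d →ₗ[ℂ] MatrixSum r) ∘ₗ κ ∘ₗ ψ)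
    have hL (t : A) : L t = (((1 + δ)⁻¹ : ℝ) : ℂ) • φ (j (κ (ψ t))) := rfl
    rw [← hL]
    refine (hTM k L (δ * (1 + R)) (fun t ht => ?_) (by positivity)).trans_lt ?_
    · have ht' : t ∈ T' := Finset.mem_biUnion.mpr ⟨k, Finset.mem_univ k, ht⟩
      have htR : ‖t‖ ≤ R := Finset.single_le_sum (f := fun t : A => ‖t‖)
        (fun t _ => norm_nonneg t) ht'
      rw [hL, hjκ]
      have e1 : (((1 + δ)⁻¹ : ℝ) : ℂ) • φ (p * ψ t * p) - t =
          (((1 + δ)⁻¹ : ℝ) : ℂ) • ((φ (p * ψ t * p) - t) - (δ : ℂ) • t) := by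
        have h3 : t = (((1 + δ)⁻¹ : ℝ) : ℂ) • ((1 + δ : ℝ) : ℂ) • t := by
          rw [smul_smul, ← Complex.ofReal_mul, inv_mul_cancel₀ (by positivity)]; simp
        nth_rewrite 2 [h3]
        rw [← smul_sub]
        congr 1
        push_cast
        rw [add_smul, one_smul]
        abel
      rw [e1, norm_smul, Complex.norm_real, Real.norm_of_nonneg (by positivity)]
      have h4 : (1 + δ)⁻¹ ≤ 1 := inv_le_one_of_one_le₀ (by linarith)
      calc (1 + δ)⁻¹ * ‖φ (p * ψ t * p) - t - (δ : ℂ) • t‖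
          ≤ 1 * (δ + δ * R) := by
            gcongr
            refine (norm_sub_le _ _).trans ?_
            rw [norm_smul, Complex.norm_real, Real.norm_of_nonneg hδ.le]
            gcongr
            exact hap t ht'
        _ = δ * (1 + R) := by ring
    · refine lt_of_le_of_lt ?_ hδε
      gcongr
      exact Finset.single_le_sum (f := M) (fun k _ => hM k) (Finset.mem_univ k)
  · refine OrthogonalOnColors.isDecomposable (c := c) fun i e f he hf _ _ hei hfi hef => ?_
    have hproj {e : MatrixSum d} (he : IsStarProjection e) : IsStarProjection (j e) :=
      ⟨by rw [IsIdempotentElem, ← map_mul, he.isIdempotentElem.eq],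
        by rw [IsSelfAdjoint, ← map_star, he.isSelfAdjoint.star_eq]⟩
    have key := horth i (j e) (j f) (hproj he) (hproj hf) (hpj e) (hpj f)
      (by rw [← hjP, hei]) (by rw [← hjP, hfi]) (by rw [← map_mul, hef, map_zero])
    change ((((1 + δ)⁻¹ : ℝ) : ℂ) • φ (j e)) * ((((1 + δ)⁻¹ : ℝ) : ℂ) • φ (j f)) = 0
    rw [smul_mul_smul_comm, key, smul_zero]

lemma DecompositionRankLE.exists_approx (h : DecompositionRankLE A n) (T : Finset A) {δ : ℝ}
    (hδ : 0 < δ) :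
    ∃ (s : ℕ) (r : Fin s → ℕ) (ψ : A →ₗ[ℂ] MatrixSum r) (φ : MatrixSum r →ₗ[ℂ] A)
      (c : Fin s → Fin (n + 1)),
      IsCompletelyPositive ψ ∧ IsCompletelyPositive φ ∧ (∀ a, ‖ψ a‖ ≤ ‖a‖) ∧
      (∀ x, ‖φ x‖ ≤ ‖x‖) ∧ (∀ b ∈ T, ‖φ (ψ b) - b‖ ≤ δ) ∧ OrthogonalOnColors c 1 φ := by
  obtain ⟨s, r, ψ, φ, hψ, hφ, hap, hdec⟩ := h T.card (fun k => (T.equivFin.symm k : A)) δ hδ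
  obtain ⟨c, hc⟩ := hdec.exists_orthogonalOnColors
  refine ⟨s, r, ψ.toLinearMap, φ.toLinearMap, c, ψ.isCompletelyPositive, φ.isCompletelyPositive,
    hψ, hφ, fun b hb => ?_, hc⟩
  have := hap (T.equivFin ⟨b, hb⟩)
  rw [Equiv.symm_apply_apply] at this
  exact this.le

lemma exists_approximate_unit (T : Finset A) {ε : ℝ} (hε : 0 < ε) :
    ∃ v : A, 0 ≤ v ∧ ‖v‖ ≤ 1 ∧ ∀ a ∈ T, ‖v * a - a‖ ≤ ε ∧ ‖v * a * v - a‖ ≤ ε := by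
  have hl := CStarAlgebra.increasingApproximateUnit A
  have := hl.neBot
  have h1 : ∀ᶠ v in CStarAlgebra.approximateUnit A, ∀ a ∈ T,
      ‖v * a - a‖ ≤ ε / 2 ∧ ‖a * v - a‖ ≤ ε / 2 := by
    rw [Filter.eventually_all_finset]
    intro a _
    have e1 := (hl.tendsto_mul_right a).eventually (Metric.closedBall_mem_nhds a (half_pos hε))
    have e2 := (hl.tendsto_mul_left a).eventually (Metric.closedBall_mem_nhds a (half_pos hε))
    filter_upwards [e1, e2] with v hv1 hv2
    rw [dist_eq_norm] at hv1 hv2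
    exact ⟨hv1, hv2⟩
  obtain ⟨v, hv1, hv0, hvn⟩ := (h1.and (hl.eventually_nonneg.and hl.eventually_norm)).exists
  refine ⟨v, hv0, hvn, fun a ha => ⟨(hv1 a ha).1.trans (by linarith), ?_⟩⟩
  have e : v * a * v - a = v * (a * v - a) + (v * a - a) := by noncomm_ring
  rw [e]
  calc _ ≤ ‖v‖ * ‖a * v - a‖ + ‖v * a - a‖ := (norm_add_le _ _).trans (by gcongr; exact norm_mul_le _ _)
    _ ≤ 1 * (ε / 2) + ε / 2 := by
      gcongr
      · exact (hv1 a ha).2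
      · exact (hv1 a ha).1
    _ = ε := by ring

end Criterion

/-! ### Cutting down an order zero map -/

section Cut

variable {F B : Type*} [CStarAlgebra F] [PartialOrder F] [StarOrderedRing F]
  [CStarAlgebra B] [PartialOrder B] [StarOrderedRing B]

lemma le_one_of_norm_le_one {a : B} (ha : 0 ≤ a) (h : ‖a‖ ≤ 1) : a ≤ 1 :=
  (CStarAlgebra.norm_le_one_iff_of_nonneg a ha).mp h

lemma norm_le_one_of_nonneg_of_le_one {a : B} (ha : 0 ≤ a) (h : a ≤ 1) : ‖a‖ ≤ 1 :=
  (CStarAlgebra.norm_le_one_iff_of_nonneg a ha).mpr h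

lemma IsStarProjection.le_one' {p : B} (hp : IsStarProjection p) : p ≤ 1 :=
  le_one_of_norm_le_one hp.nonneg hp.norm_le

lemma norm_cutoff_conjugate_sub_le {c y : B} (hc : 0 ≤ c) (hy : 0 ≤ y) (hyc : y ≤ c)
    (hy1 : y ≤ 1) {θ : ℝ} (hθ : 0 < θ) :
    ‖cutoff θ c * y * cutoff θ c - y‖ ≤ 2 * Real.sqrt θ :=
  norm_conjugate_sub_le hy hyc hy1 (cutoff_isSelfAdjoint hθ) (norm_cutoff_le_one hθ)
    (norm_one_sub_cutoff_mul_self_mul_le hθ hc)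

omit [PartialOrder B] [StarOrderedRing B] [PartialOrder F] [StarOrderedRing F] in
/-- Cutting down by the functional calculus of `φ q` preserves orthogonality of images of
orthogonal projections below `q`. -/
lemma cutoff_conjugate_mul_eq_zero {φ : F →ₗ[ℂ] B} {q e f : F} (hq : IsSelfAdjoint (φ q))
    (h1 : φ e * φ (q - e) = 0) (h2 : φ (q - e) * φ e = 0) (h3 : φ e * φ f = 0) (θ : ℝ) :
    (cutoff θ (φ q) * φ e * cutoff θ (φ q)) * (cutoff θ (φ q) * φ f * cutoff θ (φ q)) = 0 := by
  have hcomm : Commute (φ e) (φ q) := by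
    rw [map_sub, mul_sub, sub_eq_zero] at h1
    rw [map_sub, sub_mul, sub_eq_zero] at h2
    rw [Commute, SemiconjBy, h1, h2]
  have hk := (hcomm.cutoff_right hq θ).eq
  set k := cutoff θ (φ q)
  calc k * φ e * k * (k * φ f * k) = k * (φ e * k) * k * φ f * k := by simp only [mul_assoc]
    _ = k * k * (φ e * k) * φ f * k := by nth_rewrite 1 [hk]; simp only [mul_assoc]
    _ = k * k * k * (φ e * φ f) * k := by rw [hk]; simp only [mul_assoc]
    _ = 0 := by rw [h3]; simp

end Cut

/-! ### Compression to blocks -/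

section BlockConjugation

variable {ι : Type} [Fintype ι] {r : ι → ℕ}

omit [Fintype ι] in
lemma blockProj_mul_mul_blockProj (P : ι → Prop) (x : MatrixSum r) :
    blockProj r P * x * blockProj r P = blockProj r P * x := by
  rw [mul_assoc, ← blockProj_comm, ← mul_assoc, (isStarProjection_blockProj P).isIdempotentElem.eq]

lemma blockProj_mul_nonneg (P : ι → Prop) {x : MatrixSum r} (hx : 0 ≤ x) :
    0 ≤ blockProj r P * x := by
  rw [← blockProj_mul_mul_blockProj]
  exact (isStarProjection_blockProj P).isSelfAdjoint.conjugate_nonneg hx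

lemma blockProj_mul_le (P : ι → Prop) {x : MatrixSum r} (hx : 0 ≤ x) :
    blockProj r P * x ≤ x := by
  have h : IsStarProjection (1 - blockProj r P) := (isStarProjection_blockProj P).one_sub
  have e : x - blockProj r P * x = (1 - blockProj r P) * x * (1 - blockProj r P) := by
    have := blockProj_mul_mul_blockProj P x
    rw [sub_mul, one_mul, mul_sub, mul_one, sub_mul, this, ← blockProj_comm]
    abel
  rw [← sub_nonneg, e]
  exact h.isSelfAdjoint.conjugate_nonneg hx

omit [Fintype ι] in
lemma isStarProjection_blockProj_mul (P : ι → Prop) {p : MatrixSum r} (hp : IsStarProjection p) :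
    IsStarProjection (blockProj r P * p) := by
  have hP := isStarProjection_blockProj (r := r) P
  refine ⟨?_, ?_⟩
  · rw [IsIdempotentElem, ← mul_assoc, blockProj_mul_mul_blockProj, mul_assoc,
      hp.isIdempotentElem.eq]
  · rw [IsSelfAdjoint, star_mul, hP.isSelfAdjoint.star_eq, hp.isSelfAdjoint.star_eq,
      blockProj_comm]

omit [Fintype ι] in
lemma sum_blockProj_mul {κ : Type*} [Fintype κ] (c : ι → κ) (x : MatrixSum r) :
    ∑ j, blockProj r (fun i => c i = j) * x = x := by
  rw [← Finset.sum_mul, sum_blockProj, one_mul]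

end BlockConjugation

/-! ### The unitization and its character -/

section Character

variable {A : Type*} [NonUnitalCStarAlgebra A] [PartialOrder A] [StarOrderedRing A]

/-- The character of the unitization with kernel `A`. -/
noncomputable def unitizationCharacter (A : Type*) [NonUnitalCStarAlgebra A] :
    Unitization ℂ A →⋆ₐ[ℂ] ℂ :=
  { Unitization.fstHom ℂ A with map_star' := fun x => Unitization.fst_star x }

/-- The inclusion of `A` in its unitization. -/
noncomputable abbrev unitizationIncl (A : Type*) [NonUnitalCStarAlgebra A] :
    A →⋆ₙₐ[ℂ] Unitization ℂ A :=
  Unitization.inrNonUnitalStarAlgHom ℂ A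

omit [PartialOrder A] [StarOrderedRing A] in
lemma unitizationIncl_injective : Function.Injective (unitizationIncl A) :=
  Unitization.inr_injective

omit [PartialOrder A] [StarOrderedRing A] in
lemma inr_snd_of_fst_eq_zero {x : Unitization ℂ A} (h : x.fst = 0) :
    unitizationIncl A x.snd = x := by
  ext
  · simp [h]
  · simp

lemma IsCompletelyPositive.snd_comp {C : Type*} [NonUnitalCStarAlgebra C] [PartialOrder C]
    [StarOrderedRing C] {f : C →ₗ[ℂ] Unitization ℂ A} (hf : IsCompletelyPositive f)
    (h : ∀ x, (f x).fst = 0) : IsCompletelyPositive (Unitization.sndHom ℂ ℂ A ∘ₗ f) := by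
  refine .of_comp_injective (unitizationIncl A) unitizationIncl_injective ?_
  have : (unitizationIncl A : A →ₗ[ℂ] Unitization ℂ A) ∘ₗ Unitization.sndHom ℂ ℂ A ∘ₗ f = f := by
    ext1 x
    exact inr_snd_of_fst_eq_zero (h x)
  rw [this]
  exact hf

end Character

/-! ### From the unitization to the algebra -/

section UpperBound

variable {A : Type*} [NonUnitalCStarAlgebra A] [PartialOrder A] [StarOrderedRing A] {n : ℕ}

lemma DecompositionRankLE.of_unitization (h : DecompositionRankLE (Unitization ℂ A) n) :
    DecompositionRankLE A n := by
  classical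
  refine decompositionRankLE_of_approx
    (CStarAlgebra.span_nonneg_inter_unitClosedBall (A := A)) fun T hT ε hε _ => ?_
  obtain ⟨v, hv0, hv1, hvT⟩ := exists_approximate_unit T (ε := ε / 8) (by positivity)
  let N : ℝ := n + 1
  have hN : 0 < N := by positivity
  -- Cutting by p costs 2√η = ε / 4, and cutting the N = n + 1 colours costs N · 2√θ = ε / 4.
  let η : ℝ := (ε / 8) ^ 2
  let θ : ℝ := (ε / (8 * N)) ^ 2
  have hη : 0 < η := by positivity
  have hθ : 0 < θ := by positivity
  have hsη : Real.sqrt η = ε / 8 := Real.sqrt_sq (by positivity)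
  have hsθ : Real.sqrt θ = ε / (8 * N) := Real.sqrt_sq (by positivity)
  -- The bound θη survives division by η as the bound θ for the character.
  let δ : ℝ := min (ε / 8) (θ * η)
  have hδ : 0 < δ := lt_min (by positivity) (by positivity)
  let i := unitizationIncl A
  have hi0 {a : A} (ha : 0 ≤ a) : 0 ≤ i a := map_nonneg i ha
  have hin (a : A) : ‖i a‖ = ‖a‖ := Unitization.norm_inr a
  obtain ⟨s, r, ψ, φ, c, hψ, hφ, hψ1, hφ1, hap, horth⟩ := h.exists_approx
    (insert (i (v * v)) (T.image fun a => i (v * a * v))) hδ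
  have hvs : IsSelfAdjoint v := .of_nonneg hv0
  have hvv0 : 0 ≤ v * v := by simpa [hvs.star_eq] using star_mul_self_nonneg v
  set H := ψ (i (v * v)) with hHdef
  have hH : 0 ≤ H := hψ.nonneg (hi0 hvv0)
  obtain ⟨p, hp, hpH, hpη⟩ := exists_spectral_projection (F := MatrixSum r) hH hη
  let P (j : Fin (n + 1)) : MatrixSum r := blockProj r (fun i => c i = j)
  have hP (j) : IsStarProjection (P j) := isStarProjection_blockProj _
  let q (j : Fin (n + 1)) : MatrixSum r := P j * p
  have hq (j) : IsStarProjection (q j) := isStarProjection_blockProj_mul _ hp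
  let e (j : Fin (n + 1)) : Unitization ℂ A := φ (q j)
  have he (j) : 0 ≤ e j := hφ.nonneg (hq j).nonneg
  let k (j : Fin (n + 1)) : Unitization ℂ A := cutoff θ (e j)
  have hks (j) : IsSelfAdjoint (k j) := cutoff_isSelfAdjoint hθ
  -- Each colour has its own cutoff, because φ(e) is known to commute with φ(q j) only when e has
  -- colour j.
  let Φ : MatrixSum r →ₗ[ℂ] Unitization ℂ A :=
    ∑ j, conjugation (k j) ∘ₗ φ ∘ₗ conjugation (P j)
  have hΦ : IsCompletelyPositive Φ := .sum _ fun j =>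
    (IsCompletelyPositive.conjugation _).comp (hφ.comp (.conjugation _))
  have hΦx (x) : Φ x = ∑ j, k j * φ (P j * x) * k j := by
    simp only [Φ, LinearMap.sum_apply, LinearMap.comp_apply, conjugation_apply, (hks _).star_eq]
    refine Finset.sum_congr rfl fun j _ => ?_
    rw [(hP j).isSelfAdjoint.star_eq, blockProj_mul_mul_blockProj]
  have hφ_one {x : MatrixSum r} (hx0 : 0 ≤ x) (hx1 : x ≤ 1) : φ x ≤ 1 :=
    le_one_of_norm_le_one (hφ.nonneg hx0)
      ((hφ1 x).trans (norm_le_one_of_nonneg_of_le_one hx0 hx1))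
  -- The character vanishes on the range of `Φ`.
  have hchar (j) : unitizationCharacter A (e j) ≤ θ := by
    have h1 : η • e j ≤ φ H := by
      calc η • e j ≤ η • φ p := smul_le_smul_of_nonneg_left
            (hφ.mono (blockProj_mul_le _ hp.nonneg)) hη.le
        _ = φ ((η : ℂ) • p) := by rw [map_smul, Complex.coe_smul]
        _ ≤ φ H := hφ.mono hpH
    have h2 := (hap (i (v * v)) (Finset.mem_insert_self _ _)).trans (min_le_right _ _)
    -- The character vanishes at v², and φ(H) is within θη of v².
    have h3 : ‖unitizationCharacter A (φ H)‖ ≤ θ * η := by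
      have h4 : unitizationCharacter A (φ H) = unitizationCharacter A (φ H - i (v * v)) := by
        rw [map_sub]
        have : unitizationCharacter A (i (v * v)) = 0 := rfl
        rw [this, sub_zero]
      rw [h4]
      exact (NonUnitalStarAlgHom.norm_apply_le (unitizationCharacter A) _).trans h2
    have h5 : η • unitizationCharacter A (e j) ≤ unitizationCharacter A (φ H) := by
      rw [← Complex.coe_smul, ← map_smul, Complex.coe_smul]
      exact OrderHomClass.mono (unitizationCharacter A) h1
    have h6 : unitizationCharacter A (φ H) ≤ ((θ * η : ℝ) : ℂ) := by
      have h7 : 0 ≤ unitizationCharacter A (φ H) := map_nonneg _ (hφ.nonneg hH)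
      rw [Complex.eq_re_of_ofReal_le h7]
      exact_mod_cast (Complex.re_le_norm _).trans h3
    have h8 := smul_le_smul_of_nonneg_left (h5.trans h6) (inv_nonneg.mpr hη.le)
    rw [smul_smul, inv_mul_cancel₀ hη.ne', one_smul] at h8
    refine h8.trans (le_of_eq ?_)
    rw [Complex.real_smul, ← Complex.ofReal_mul]
    congr 1
    field_simp
  have hfst (x) : (Φ x).fst = 0 := by
    change unitizationCharacter A (Φ x) = 0
    rw [hΦx, map_sum]
    refine Finset.sum_eq_zero fun j _ => ?_
    rw [map_mul, map_cutoff_eq_zero hθ (he j) _ (hchar j), mul_zero]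
  let Φ' : MatrixSum r →ₗ[ℂ] A := Unitization.sndHom ℂ ℂ A ∘ₗ Φ
  have hΦ' (x) : i (Φ' x) = Φ x := inr_snd_of_fst_eq_zero (hfst x)
  have hcontr (x) : ‖Φ (p * x * p)‖ ≤ ‖x‖ := by
    have h1 : IsCompletelyPositive (Φ ∘ₗ conjugation p) := hΦ.comp (.conjugation p)
    -- The cutoffs only decrease each φ(q j), and these sum to φ(p) ≤ 1; so no contractivity is
    -- lost.
    have h2 : (Φ ∘ₗ conjugation p) 1 ≤ algebraMap ℝ _ 1 := by
      rw [LinearMap.comp_apply, conjugation_apply, mul_one, hp.isSelfAdjoint.star_eq,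
        hp.isIdempotentElem.eq, hΦx, map_one]
      calc ∑ j, k j * e j * k j ≤ ∑ j, e j :=
            Finset.sum_le_sum fun j _ => cutoff_mul_self_mul_cutoff_le hθ (he j)
        _ = φ p := by rw [← map_sum]; congr 1; exact sum_blockProj_mul c p
        _ ≤ 1 := hφ_one hp.nonneg hp.le_one'
    have h3 := h1.norm_apply_le one_pos h2 x
    rwa [one_mul, LinearMap.comp_apply, conjugation_apply, hp.isSelfAdjoint.star_eq] at h3
  refine ⟨s, r, ψ ∘ₗ (i : A →ₗ[ℂ] Unitization ℂ A), Φ', p, c, hψ.comp (.starHom i),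
    hΦ.snd_comp hfst, hp, fun a => (hψ1 (i a)).trans (hin a).le, fun x => ?_, fun a ha => ?_, ?_⟩
  · rw [← hin, hΦ']
    refine (hcontr x).trans ?_
    nlinarith [norm_nonneg x]
  · obtain ⟨ha0, ha1⟩ := hT ha
    replace ha0 : 0 ≤ a := ha0
    replace ha1 : ‖a‖ ≤ 1 := by simpa using ha1
    rw [← hin, map_sub, hΦ', LinearMap.comp_apply]
    change ‖Φ (p * ψ (i a) * p) - i a‖ ≤ ε
    set b := i (v * a * v) with hb
    have hab : ‖i a - b‖ ≤ ε / 8 := by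
      rw [hb, ← map_sub, hin, norm_sub_rev]; exact (hvT a ha).2
    -- The inequality is proved in the unitization, where a ≤ 1 makes sense.
    have hvav : v * a * v ≤ v * v := by
      have h1 : i (v * a * v) ≤ i (v * v) := by
        have h2 : i a ≤ 1 := le_one_of_norm_le_one (hi0 ha0) (by rw [hin]; exact ha1)
        have := (hvs.map i).conjugate_le_conjugate h2
        rwa [mul_one, ← map_mul, ← map_mul, ← map_mul] at this
      rw [← sub_nonneg, ← map_sub] at h1
      exact sub_nonneg.mp (nonneg_of_map_nonneg i unitizationIncl_injective h1)
    set y := ψ b with hy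
    have hb0 : 0 ≤ v * a * v := hvs.conjugate_nonneg ha0
    have hvvn : ‖v * v‖ ≤ 1 := (norm_mul_le _ _).trans (by nlinarith [norm_nonneg v])
    have hy0 : 0 ≤ y := hψ.nonneg (hi0 hb0)
    have hyH : y ≤ H := hψ.mono (OrderHomClass.mono i hvav)
    have hH1 : H ≤ 1 := le_one_of_norm_le_one hH
      ((hψ1 _).trans (by rw [hin]; exact hvvn))
    have hy1 : y ≤ 1 := hyH.trans hH1
    have hpy : ‖p * y * p - y‖ ≤ 2 * Real.sqrt η :=
      norm_conjugate_sub_le hy0 hyH hy1 hp.isSelfAdjoint hp.norm_le hpη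
    set z := p * y * p with hz
    have hz0 : 0 ≤ z := hp.isSelfAdjoint.conjugate_nonneg hy0
    have hzp : z ≤ p := by
      have := hp.isSelfAdjoint.conjugate_le_conjugate hy1
      rwa [mul_one, hp.isIdempotentElem.eq] at this
    have hz1 : z ≤ 1 := hzp.trans hp.le_one'
    have hcut (j) : ‖k j * φ (P j * z) * k j - φ (P j * z)‖ ≤ 2 * Real.sqrt θ := by
      have hPz : 0 ≤ P j * z := blockProj_mul_nonneg _ hz0
      refine norm_cutoff_conjugate_sub_le (he j) (hφ.nonneg hPz) (hφ.mono ?_)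
        (hφ_one hPz ((blockProj_mul_le _ hz0).trans hz1)) hθ
      have := blockProj_mul_nonneg (r := r) (fun i => c i = j) (sub_nonneg.mpr hzp)
      rwa [mul_sub, sub_nonneg] at this
    have hsum : ‖Φ z - φ z‖ ≤ N * (2 * Real.sqrt θ) := by
      have h1 : φ z = ∑ j, φ (P j * z) := by
        rw [← map_sum]; congr 1; exact (sum_blockProj_mul c z).symm
      rw [hΦx, h1, ← Finset.sum_sub_distrib]
      refine (norm_sum_le _ _).trans ((Finset.sum_le_sum fun j _ => hcut j).trans ?_)
      simp [N]
    have h1 : ‖Φ (p * ψ (i a) * p) - Φ z‖ ≤ ε / 8 := by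
      rw [← map_sub, hz, ← sub_mul, ← mul_sub, hy, ← map_sub]
      exact (hcontr _).trans ((hψ1 _).trans hab)
    have h2 : ‖φ z - φ y‖ ≤ 2 * Real.sqrt η := by
      rw [← map_sub]; exact (hφ1 _).trans hpy
    have h3 : ‖φ y - b‖ ≤ ε / 8 :=
      (hap b (Finset.mem_insert_of_mem (Finset.mem_image_of_mem _ ha))).trans (min_le_left _ _)
    have h4 : ‖b - i a‖ ≤ ε / 8 := by rw [norm_sub_rev]; exact hab
    rw [hsη] at h2
    have h5 : N * (2 * Real.sqrt θ) = ε / 4 := by rw [hsθ]; field_simp; ring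
    rw [h5] at hsum
    -- The five errors are ε/8, ε/4, ε/4, ε/8 and ε/8.
    have e1 : Φ (p * ψ (i a) * p) - i a = (Φ (p * ψ (i a) * p) - Φ z) + (Φ z - φ z) +
      (φ z - φ y) + (φ y - b) + (b - i a) := by abel
    rw [e1]
    refine (norm_add_le _ _).trans ?_
    refine (add_le_add_left ((norm_add_le _ _).trans
      (add_le_add_left ((norm_add_le _ _).trans (add_le_add_left (norm_add_le _ _) _)) _)) _).trans ?_
    linarith
  · intro j f g hf hg hpf hpg hjf hjg hfg
    apply unitizationIncl_injective
    rw [map_mul, map_zero]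
    change i (Φ' f) * i (Φ' g) = 0
    rw [hΦ', hΦ']
    have hone {f : MatrixSum r} (hjf : P j * f = f) : Φ f = k j * φ f * k j := by
      rw [hΦx, Finset.sum_eq_single j]
      · rw [hjf]
      · intro l _ hl
        have : P l * f = 0 := by
          rw [← hjf, ← mul_assoc]
          have : P l * P j = 0 :=
            blockProj_mul_blockProj_of_disjoint fun i h1 h2 => hl (h1.symm.trans h2)
          rw [this, zero_mul]
        rw [this, map_zero, mul_zero, zero_mul]
      · simp
    rw [hone hjf, hone hjg]
    have hqf : q j * f = f := by
      change P j * p * f = f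
      rw [mul_assoc, hpf, hjf]
    have hfq := (hq j).mul_eq_right_of_mul_eq_left hf hqf
    have hsub := (hq j).sub_of_mul_eq hf hqf
    have hPq : P j * q j = q j := by
      change P j * (P j * p) = P j * p
      rw [← mul_assoc, (hP j).isIdempotentElem.eq]
    have hPsub : P j * (q j - f) = q j - f := by rw [mul_sub, hPq, hjf]
    refine cutoff_conjugate_mul_eq_zero (hφ.isSelfAdjoint_apply (hq j)) ?_ ?_ ?_ θ
    · exact horth j f _ hf hsub (one_mul _) (one_mul _) hjf hPsub
        (by rw [mul_sub, hfq, hf.isIdempotentElem.eq, sub_self])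
    · exact horth j _ f hsub hf (one_mul _) (one_mul _) hPsub hjf
        (by rw [sub_mul, hqf, hf.isIdempotentElem.eq, sub_self])
    · exact horth j f g hf hg (one_mul _) (one_mul _) hjf hjg hfg

end UpperBound

/-! ### From the algebra to the unitization -/

section LowerBound

/-- With q = b*b, the map is z ↦ b*(z1)b, a homomorphism followed by a conjugation. -/
lemma IsCompletelyPositive.toSpanSingleton {B : Type*} [CStarAlgebra B] [PartialOrder B]
    [StarOrderedRing B] {q : B} (hq : 0 ≤ q) :
    IsCompletelyPositive (LinearMap.toSpanSingleton ℂ B q) := by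
  obtain ⟨b, rfl⟩ := nonneg_iff_exists_star_mul_self.mp hq
  let f : ℂ →⋆ₙₐ[ℂ] B := (StarAlgHom.ofId ℂ B : ℂ →⋆ₐ[ℂ] B)
  have : LinearMap.toSpanSingleton ℂ B (star b * b) =
      _root_.conjugation b ∘ₗ (f : ℂ →ₗ[ℂ] B) := by
    ext
    simp [f]
  rw [this]
  exact (IsCompletelyPositive.conjugation b).comp (.starHom f)

lemma blockProj_add_compl {ι : Type} {r : ι → ℕ} (P : ι → Prop) :
    blockProj r P + blockProj r (fun i => ¬ P i) = 1 := by
  funext i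
  by_cases h : P i <;> simp [blockProj, h]

lemma norm_one_sub_conjugate_sub_le {B : Type*} [CStarAlgebra B] {d g : B} (hd : IsSelfAdjoint d)
    (hg : IsSelfAdjoint g) (h : ‖1 - g‖ ≤ 1) : ‖(1 - g) * d * (1 - g) - d‖ ≤ 2 * ‖d * g‖ := by
  have e : (1 - g) * d * (1 - g) - d = -(d * g) - g * d * (1 - g) := by noncomm_ring
  have h1 : ‖g * d‖ = ‖d * g‖ := by rw [← norm_star, star_mul, hd.star_eq, hg.star_eq]
  rw [e]
  calc _ ≤ ‖d * g‖ + ‖g * d‖ * ‖1 - g‖ := by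
        refine (norm_sub_le _ _).trans ?_
        rw [norm_neg]
        gcongr
        exact norm_mul_le _ _
    _ ≤ ‖d * g‖ + ‖g * d‖ * 1 := by gcongr
    _ = 2 * ‖d * g‖ := by rw [h1]; ring

variable {A : Type*} [NonUnitalCStarAlgebra A] [PartialOrder A] [StarOrderedRing A] {n : ℕ}

omit [PartialOrder A] [StarOrderedRing A] in
lemma span_insert_one_image_unitizationIncl {S : Set A} (hS : Submodule.span ℂ S = ⊤) :
    Submodule.span ℂ (insert 1 (unitizationIncl A '' S)) = ⊤ := by
  rw [eq_top_iff]
  intro x _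
  have h1 : x = x.fst • (1 : Unitization ℂ A) + unitizationIncl A x.snd := by
    ext <;> simp
  rw [h1]
  refine Submodule.add_mem _ (Submodule.smul_mem _ _ (Submodule.subset_span (by simp))) ?_
  have h2 : x.snd ∈ Submodule.span ℂ S := by rw [hS]; trivial
  have h3 := Submodule.mem_map_of_mem
    (f := (unitizationIncl A : A →ₗ[ℂ] Unitization ℂ A)) h2
  rw [Submodule.map_span] at h3
  exact Submodule.span_mono (Set.subset_insert _ _) h3

/-- `ψ` extended to a unital map on the unitization, after compression by `u`. -/
noncomputable def unitalExtension {F : Type*} [CStarAlgebra F] (ψ : A →ₗ[ℂ] F) (u : A) :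
    Unitization ℂ A →ₗ[ℂ] F :=
  ψ ∘ₗ Unitization.sndHom ℂ ℂ A ∘ₗ conjugation (unitizationIncl A u) +
    LinearMap.toSpanSingleton ℂ F (1 - ψ (star u * u)) ∘ₗ (unitizationCharacter A).toLinearMap

omit [PartialOrder A] [StarOrderedRing A] in
lemma fst_conjugation_unitizationIncl (u : A) (x : Unitization ℂ A) :
    (conjugation (unitizationIncl A u) x).fst = 0 := by
  simp

lemma isCompletelyPositive_unitalExtension {F : Type*} [CStarAlgebra F] [PartialOrder F]
    [StarOrderedRing F] {ψ : A →ₗ[ℂ] F} (hψ : IsCompletelyPositive ψ) {u : A}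
    (h : ψ (star u * u) ≤ 1) : IsCompletelyPositive (unitalExtension ψ u) := by
  refine .add (hψ.comp ?_) (.comp (.toSpanSingleton (sub_nonneg.mpr h))
    (.starHom (unitizationCharacter A : Unitization ℂ A →⋆ₙₐ[ℂ] ℂ)))
  exact (IsCompletelyPositive.conjugation _).snd_comp (fst_conjugation_unitizationIncl u)

omit [PartialOrder A] [StarOrderedRing A] in
lemma unitalExtension_one {F : Type*} [CStarAlgebra F] (ψ : A →ₗ[ℂ] F) (u : A) :
    unitalExtension ψ u 1 = 1 := by
  have h1 : (conjugation (unitizationIncl A u) 1).snd = star u * u := by simp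
  have h2 : unitizationCharacter A 1 = 1 := map_one _
  change ψ (conjugation (unitizationIncl A u) 1).snd +
    unitizationCharacter A 1 • (1 - ψ (star u * u)) = 1
  rw [h1, h2, one_smul]
  abel

omit [PartialOrder A] [StarOrderedRing A] in
lemma unitalExtension_incl {F : Type*} [CStarAlgebra F] (ψ : A →ₗ[ℂ] F) (u a : A) :
    unitalExtension ψ u (unitizationIncl A a) = ψ (star u * a * u) := by
  have h1 : (conjugation (unitizationIncl A u) (unitizationIncl A a)).snd = star u * a * u := by
    simp
  have h2 : unitizationCharacter A (unitizationIncl A a) = 0 := rfl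
  change ψ (conjugation (unitizationIncl A u) (unitizationIncl A a)).snd +
    unitizationCharacter A (unitizationIncl A a) • (1 - ψ (star u * u)) = _
  rw [h1, h2, zero_smul, add_zero]

lemma norm_mul_one_sub_mul_le {B : Type*} [CStarAlgebra B] {u v : B} (hu : ‖u‖ ≤ 1) (hv : ‖v‖ ≤ 1)
    {δ : ℝ} (h : ‖u * v - v‖ ≤ δ) : ‖v * (1 - u * u) * v‖ ≤ 2 * δ := by
  have e : v * (1 - u * u) * v = -(v * (u * (u * v - v) + (u * v - v))) := by noncomm_ring
  rw [e, norm_neg]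
  calc _ ≤ ‖v‖ * (‖u‖ * ‖u * v - v‖ + ‖u * v - v‖) :=
        (norm_mul_le _ _).trans (mul_le_mul_of_nonneg_left ((norm_add_le _ _).trans
          (add_le_add_left (norm_mul_le _ _) _)) (norm_nonneg _))
    _ ≤ 1 * (1 * δ + δ) := by gcongr
    _ = 2 * δ := by ring

set_option maxHeartbeats 1000000 in
lemma DecompositionRankLE.unitization (h : DecompositionRankLE A n) :
    DecompositionRankLE (Unitization ℂ A) n := by
  classical
  refine decompositionRankLE_of_approx (span_insert_one_image_unitizationIncl
    (CStarAlgebra.span_nonneg_inter_unitClosedBall (A := A))) fun T hT ε hε hε1 => ?_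
  let i := unitizationIncl A
  have hi0 {a : A} (ha : 0 ≤ a) : 0 ≤ i a := map_nonneg i ha
  have hin (a : A) : ‖i a‖ = ‖a‖ := Unitization.norm_inr a
  -- The errors add up to 4e₀ at the unit and to 10e₀ at elements of A.
  set e₀ : ℝ := ε / 16 with he₀
  have he₀0 : 0 < e₀ := by positivity
  have he₀1 : e₀ ≤ 1 := by linarith
  obtain ⟨v, hv0, hv1, hvT⟩ := exists_approximate_unit (T.image fun x => x.snd) he₀0
  let η : ℝ := e₀ ^ 2
  have hη : 0 < η := by positivity
  have hη1 : η ≤ 1 := pow_le_one₀ he₀0.le he₀1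
  have hsη : Real.sqrt η = e₀ := Real.sqrt_sq he₀0.le
  -- This makes the bound of `norm_mul_sq_le` at most (ηe₀)², so ‖Dd‖ ≤ ηe₀; the factor η later
  -- compensates the 1 / η of `norm_mul_cutoffUnit_le`.
  let δ : ℝ := min e₀ (η * (η * e₀) ^ 2 / 4)
  have hδ : 0 < δ := lt_min he₀0 (by positivity)
  have hδe : δ ≤ e₀ := min_le_left _ _
  have hδη : δ + η⁻¹ * (δ + 2 * δ) ≤ (η * e₀) ^ 2 := by
    have h1 : δ ≤ η * (η * e₀) ^ 2 / 4 := min_le_right _ _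
    have h2 : δ ≤ η⁻¹ * δ := by
      rw [le_inv_mul_iff₀ hη]; nlinarith
    have h3 : η⁻¹ * δ ≤ (η * e₀) ^ 2 / 4 := by
      rw [inv_mul_le_iff₀ hη]; linarith
    linarith
  -- The second approximate unit is chosen after v, so that it almost fixes v.
  obtain ⟨u, hu0, hu1, huT⟩ := exists_approximate_unit
    (insert v ((T.image fun x => x.snd).image fun a => v * a * v)) hδ
  obtain ⟨s, r, ψ, φ, c, hψ, hφ, hψ1, hφ1, hap, horth⟩ := h.exists_approx
    (insert (u * u) (insert (v * v) ((T.image fun x => x.snd).image fun a => v * a * v))) hδ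
  have hvs : IsSelfAdjoint v := .of_nonneg hv0
  have hus : IsSelfAdjoint u := .of_nonneg hu0
  have hvv0 : 0 ≤ v * v := by simpa [hvs.star_eq] using star_mul_self_nonneg v
  have huu0 : 0 ≤ u * u := by simpa [hus.star_eq] using star_mul_self_nonneg u
  have hvvn : ‖v * v‖ ≤ 1 := (norm_mul_le _ _).trans (by nlinarith [norm_nonneg v])
  have huun : ‖u * u‖ ≤ 1 := (norm_mul_le _ _).trans (by nlinarith [norm_nonneg u])
  set Φ : MatrixSum r →ₗ[ℂ] Unitization ℂ A := (i : A →ₗ[ℂ] Unitization ℂ A) ∘ₗ φ with hΦdef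
  have hΦ : IsCompletelyPositive Φ := (IsCompletelyPositive.starHom i).comp hφ
  have hΦ1 (x) : ‖Φ x‖ ≤ ‖x‖ := (hin (φ x)).trans_le (hφ1 x)
  have hΦ_one {x : MatrixSum r} (hx0 : 0 ≤ x) (hx1 : x ≤ 1) : Φ x ≤ 1 :=
    le_one_of_norm_le_one (hΦ.nonneg hx0)
      ((hΦ1 x).trans (norm_le_one_of_nonneg_of_le_one hx0 hx1))
  have hΦap {b : A} (hb : b ∈ insert (u * u) (insert (v * v)
      ((T.image fun x => x.snd).image fun a => v * a * v))) : ‖Φ (ψ b) - i b‖ ≤ δ := by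
    change ‖i (φ (ψ b)) - i b‖ ≤ δ
    rw [← map_sub, hin]
    exact hap b hb
  have hΦorth (j : Fin (n + 1)) {e f : MatrixSum r} (he : IsStarProjection e)
      (hf : IsStarProjection f) (hje : blockProj r (fun i => c i = j) * e = e)
      (hjf : blockProj r (fun i => c i = j) * f = f) (hef : e * f = 0) : Φ e * Φ f = 0 := by
    change i (φ e) * i (φ f) = 0
    rw [← map_mul, horth j e f he hf (one_mul _) (one_mul _) hje hjf hef, map_zero]
  have hψ_one {a : A} (ha0 : 0 ≤ a) (ha1 : ‖a‖ ≤ 1) : ψ a ≤ 1 :=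
    le_one_of_norm_le_one (hψ.nonneg ha0) ((hψ1 a).trans ha1)
  set H := ψ (v * v) with hHdef
  have hH : 0 ≤ H := hψ.nonneg hvv0
  have hH1 : H ≤ 1 := hψ_one hvv0 hvvn
  obtain ⟨χ, hχ, hχH, hχη⟩ := exists_spectral_projection (F := MatrixSum r) hH hη
  set P₀ : MatrixSum r := blockProj r (fun i => c i = 0) with hP₀def
  set P₁ : MatrixSum r := blockProj r (fun i => ¬ c i = 0) with hP₁def
  have hP₀ : IsStarProjection P₀ := isStarProjection_blockProj _
  have hP₁ : IsStarProjection P₁ := isStarProjection_blockProj _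
  have hPadd : P₀ + P₁ = 1 := blockProj_add_compl _
  have hP₁₀ : P₁ * P₀ = 0 := blockProj_mul_blockProj_of_disjoint fun _ h => h
  have hχ' : IsStarProjection (1 - χ) := hχ.one_sub
  have hP₀χ' : IsStarProjection (P₀ * (1 - χ)) := isStarProjection_blockProj_mul _ hχ'
  -- Only colour 0 is cut by χ. Cutting another colour would add to 1 - Φ p a term that need not be
  -- orthogonal to Φ q.
  set p : MatrixSum r := 1 - P₀ * (1 - χ) with hpdef
  have hp : IsStarProjection p := hP₀χ'.one_sub
  set q : MatrixSum r := P₀ * χ with hqdef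
  have hq : IsStarProjection q := isStarProjection_blockProj_mul _ hχ
  have hP₀p : P₀ * p = q := by
    rw [hpdef, mul_sub, mul_one, ← mul_assoc, hP₀.isIdempotentElem.eq, mul_sub, mul_one,
      sub_sub_cancel]
  have hP₁p : P₁ * p = P₁ := by
    rw [hpdef, mul_sub, mul_one, ← mul_assoc, hP₁₀, zero_mul, sub_zero]
  have hpη : ‖(1 - p) * H * (1 - p)‖ ≤ η := by
    have e1 : (1 - p) * H * (1 - p) = P₀ * ((1 - χ) * H * (1 - χ)) * P₀ := by
      have hcomm : (1 - χ) * P₀ = P₀ * (1 - χ) := (blockProj_comm _ _).symm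
      rw [hpdef, sub_sub_cancel]
      simp only [mul_assoc]
      rw [hcomm]
    rw [e1]
    calc _ ≤ ‖P₀‖ * ‖(1 - χ) * H * (1 - χ)‖ * ‖P₀‖ :=
          (norm_mul_le _ _).trans (by gcongr; exact norm_mul_le _ _)
      _ ≤ 1 * η * 1 := by
          gcongr
          · exact hP₀.norm_le
          · exact hP₀.norm_le
      _ = η := by ring
  set d : Unitization ℂ A := Φ q with hddef
  have hd0 : 0 ≤ d := hΦ.nonneg hq.nonneg
  have hd1 : d ≤ 1 := hΦ_one hq.nonneg hq.le_one'
  set k := cutoff η d with hkdef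
  have hks : IsSelfAdjoint k := cutoff_isSelfAdjoint hη
  set g := cutoffUnit η d with hgdef
  have hgs : IsSelfAdjoint g := .of_nonneg (cutoffUnit_nonneg hη hd0)
  have hgk : (1 - g) * k = 0 := one_sub_cutoffUnit_mul_cutoff hη hd0
  set D := 1 - Φ p with hDdef
  have hD0 : 0 ≤ D := sub_nonneg.mpr (hΦ_one hp.nonneg hp.le_one')
  have hDs : IsSelfAdjoint D := .of_nonneg hD0
  have hΦp : Φ p = d + Φ P₁ := by
    have e1 : P₀ * p + P₁ * p = p := by rw [← add_mul, hPadd, one_mul]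
    rw [hP₀p, hP₁p] at e1
    rw [hddef, ← map_add, e1]
  have hDd : ‖D * d‖ ≤ η * e₀ := by
    set X := 1 - Φ 1 with hX
    have hone0 : (0 : MatrixSum r) ≤ 1 := (IsStarProjection.one (MatrixSum r)).nonneg
    have hX0 : 0 ≤ X := sub_nonneg.mpr (hΦ_one hone0 le_rfl)
    have hX1 : X ≤ 1 := sub_le_self _ (hΦ.nonneg hone0)
    -- D exceeds X by the image of P₀ - q, which has colour 0 and is orthogonal to q.
    have e1 : D * d = X * d := by
      have h1 : Φ (P₀ - q) * Φ q = 0 := by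
        have hP₀q : P₀ * q = q := by rw [hqdef, ← mul_assoc, hP₀.isIdempotentElem.eq]
        refine hΦorth 0 (hP₀.sub_of_mul_eq hq hP₀q) hq ?_ hP₀q ?_
        · rw [← hP₀def, mul_sub, hP₀.isIdempotentElem.eq, hP₀q]
        · rw [sub_mul, hP₀q, hq.isIdempotentElem.eq, sub_self]
      have h2 : D = X + Φ (P₀ - q) := by
        rw [hDdef, hX, ← hPadd, hΦp, hddef, map_sub, map_add]
        abel
      rw [h2, add_mul, ← hddef.symm, h1, add_zero]
    -- Up to δ, u² is Φ(ψ(u²)), which lies below Φ(1).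
    have h1 : X ≤ (1 - i u * i u) + δ • 1 := by
      have h2 : i (u * u) ≤ Φ (ψ (u * u)) + δ • 1 :=
        le_add_smul_one_of_norm_sub_le (.of_nonneg (hi0 huu0))
          (.of_nonneg (hΦ.nonneg (hψ.nonneg huu0)))
          (by rw [norm_sub_rev]; exact hΦap (by simp))
      have h3 : Φ (ψ (u * u)) ≤ Φ 1 := hΦ.mono (hψ_one huu0 huun)
      rw [hX, ← map_mul, sub_add_eq_add_sub, sub_le_sub_iff]
      calc 1 + i (u * u) ≤ 1 + (Φ 1 + δ • 1) := by gcongr; exact h2.trans (by gcongr)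
        _ = 1 + δ • 1 + Φ 1 := by abel
    have h2 : η • d ≤ i v * i v + δ • 1 := by
      have h3 : Φ H ≤ i (v * v) + δ • 1 :=
        le_add_smul_one_of_norm_sub_le (.of_nonneg (hΦ.nonneg hH)) (.of_nonneg (hi0 hvv0))
          (hΦap (by simp))
      rw [← map_mul]
      refine le_trans ?_ h3
      calc η • d ≤ η • Φ χ := smul_le_smul_of_nonneg_left
            (hΦ.mono (blockProj_mul_le _ hχ.nonneg)) hη.le
        _ = Φ ((η : ℂ) • χ) := by rw [map_smul, Complex.coe_smul]
        _ ≤ Φ H := hΦ.mono hχH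
    have h3 : ‖i v * (1 - i u * i u) * i v‖ ≤ 2 * δ := by
      refine norm_mul_one_sub_mul_le (by rwa [hin]) (by rwa [hin]) ?_
      rw [← map_mul, ← map_sub, hin]
      exact (huT v (by simp)).1
    have huu1 : i u * i u ≤ 1 := by
      rw [← map_mul]; exact le_one_of_norm_le_one (hi0 huu0) (by rw [hin]; exact huun)
    have huu0' : 0 ≤ i u * i u := by rw [← map_mul]; exact hi0 huu0
    have h4 := norm_mul_sq_le hX0 hX1 hd0 hd1 (sub_nonneg.mpr huu1) (sub_le_self _ huu0')
      (hvs.map i) hδ.le hη h1 h2 h3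
    rw [e1]
    exact (pow_le_pow_iff_left₀ (norm_nonneg _) (by positivity) two_ne_zero).mp (h4.trans hδη)
  -- Since Dg is small, D' stays close to D, while (1 - g)k = 0 makes D' exactly orthogonal to k.
  set D' := (1 - g) * D * (1 - g) with hD'def
  have h1gs : IsSelfAdjoint (1 - g) := (IsSelfAdjoint.one _).sub hgs
  have hD'0 : 0 ≤ D' := h1gs.conjugate_nonneg hD0
  have hD's : IsSelfAdjoint D' := .of_nonneg hD'0
  have hD'D : ‖D' - D‖ ≤ 2 * e₀ := by
    refine (norm_one_sub_conjugate_sub_le hDs hgs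
      (norm_one_sub_cutoffUnit_le_one hη hd0)).trans ?_
    gcongr
    refine (norm_mul_cutoffUnit_le hη hd0 D).trans ?_
    rw [mul_inv_le_iff₀ hη, mul_comm e₀]
    exact hDd
  have hD'k : D' * k = 0 := by rw [hD'def, mul_assoc, hgk, mul_zero]
  have hkD' : k * D' = 0 := by
    have := congrArg star hD'k
    rwa [star_mul, hD's.star_eq, hks.star_eq, star_zero] at this
  obtain ⟨r', π₀, π₁, ι₀, ι₁, h00, h10, h01, h11, hπ₀1, hπ₁1, hext, hπ₁P, hπ₀P⟩ :=
    MatrixSum.exists_adjoin_block r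
  -- Both coordinates are unital, so ψ' is unital and hence contractive.
  let ψ' : Unitization ℂ A →ₗ[ℂ] MatrixSum r' :=
    (ι₁ : MatrixSum r →ₗ[ℂ] MatrixSum r') ∘ₗ unitalExtension ψ u +
      (ι₀ : ℂ →ₗ[ℂ] MatrixSum r') ∘ₗ (unitizationCharacter A).toLinearMap
  have hψ' : IsCompletelyPositive ψ' :=
    .add ((IsCompletelyPositive.starHom ι₁).comp (isCompletelyPositive_unitalExtension hψ
      (by rw [hus.star_eq]; exact hψ_one huu0 huun)))
      ((IsCompletelyPositive.starHom ι₀).comp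
        (.starHom (unitizationCharacter A : Unitization ℂ A →⋆ₙₐ[ℂ] ℂ)))
  have hψ'x (x) : ψ' x = ι₁ (unitalExtension ψ u x) + ι₀ (unitizationCharacter A x) := rfl
  have hψ'one : ψ' 1 = 1 := by
    have h1 : unitizationCharacter A 1 = 1 := map_one _
    rw [hψ'x, unitalExtension_one, h1]
    refine hext _ _ ?_ ?_
    · rw [map_add, h01, h00, hπ₀1, zero_add]
    · rw [map_add, h11, h10, hπ₁1, add_zero]
  let φ' : MatrixSum r' →ₗ[ℂ] Unitization ℂ A :=
    (conjugation k ∘ₗ Φ ∘ₗ conjugation P₀ + Φ ∘ₗ conjugation P₁) ∘ₗ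
        (π₁ : MatrixSum r' →ₗ[ℂ] MatrixSum r) +
      LinearMap.toSpanSingleton ℂ _ D' ∘ₗ (π₀ : MatrixSum r' →ₗ[ℂ] ℂ)
  have hφ' : IsCompletelyPositive φ' :=
    .add (.comp (.add ((IsCompletelyPositive.conjugation k).comp (hΦ.comp (.conjugation P₀)))
      (hΦ.comp (.conjugation P₁))) (.starHom π₁))
      (.comp (.toSpanSingleton hD'0) (.starHom π₀))
  have hφ'x (x) : φ' x = k * Φ (P₀ * π₁ x) * k + Φ (P₁ * π₁ x) + π₀ x • D' := by
    change star k * Φ (star P₀ * π₁ x * P₀) * k + Φ (star P₁ * π₁ x * P₁) + π₀ x • D' = _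
    rw [hks.star_eq, hP₀.isSelfAdjoint.star_eq, hP₁.isSelfAdjoint.star_eq,
      blockProj_mul_mul_blockProj, blockProj_mul_mul_blockProj]
  let p' : MatrixSum r' := ι₁ p + ι₀ 1
  have hπ₀p : π₀ p' = 1 := by rw [map_add, h01, h00, zero_add]
  have hπ₁p : π₁ p' = p := by rw [map_add, h11, h10, add_zero]
  have hp' : IsStarProjection p' := by
    refine ⟨hext _ _ ?_ ?_, hext _ _ ?_ ?_⟩
    · rw [map_mul, hπ₀p, one_mul]
    · rw [map_mul, hπ₁p, hp.isIdempotentElem.eq]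
    · rw [map_star, hπ₀p, star_one]
    · rw [map_star, hπ₁p, hp.isSelfAdjoint.star_eq]
  have hφ'p : φ' p' = k * d * k + Φ P₁ + D' := by
    rw [hφ'x, hπ₀p, hπ₁p, hP₀p, hP₁p, one_smul]
  have hcontr (x) : ‖φ' (p' * x * p')‖ ≤ (1 + ε) * ‖x‖ := by
    have h1 : IsCompletelyPositive (φ' ∘ₗ conjugation p') := hφ'.comp (.conjugation p')
    have h2 : (φ' ∘ₗ conjugation p') 1 ≤ algebraMap ℝ _ (1 + ε) := by
      rw [LinearMap.comp_apply, conjugation_apply, mul_one, hp'.isSelfAdjoint.star_eq,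
        hp'.isIdempotentElem.eq, hφ'p, Algebra.algebraMap_eq_smul_one, add_smul, one_smul]
      -- Replacing D' by D and dropping the cutoff yields d + Φ P₁ + (1 - Φ p) = 1; the replacement
      -- is why contractivity holds only up to ε.
      have h3 : D' ≤ D + ε • 1 := le_add_smul_one_of_norm_sub_le hD's hDs
        (hD'D.trans (by linarith))
      calc k * d * k + Φ P₁ + D' ≤ d + Φ P₁ + (D + ε • 1) := by
            gcongr
            exact cutoff_mul_self_mul_cutoff_le hη hd0
        _ = 1 + ε • 1 := by rw [← hΦp, hDdef]; abel
    have h3 := h1.norm_apply_le (by positivity) h2 x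
    rwa [LinearMap.comp_apply, conjugation_apply, hp'.isSelfAdjoint.star_eq] at h3
  -- The new block shares colour 0, so the number of colours does not grow.
  let c' : Fin (s + 1) → Fin (n + 1) := Fin.cons 0 c
  refine ⟨s + 1, r', ψ', φ', p', c', hψ', hφ', hp', fun a => ?_, hcontr, fun b hb => ?_, ?_⟩
  · have := hψ'.norm_apply_le one_pos (by rw [hψ'one, map_one]) a
    rwa [one_mul] at this
  · rcases hT hb with rfl | ⟨a, ⟨ha0, ha1⟩, rfl⟩
    · rw [hψ'one, mul_one, hp'.isIdempotentElem.eq, hφ'p]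
      have h1 : ‖k * d * k - d‖ ≤ 2 * Real.sqrt η :=
        norm_cutoff_conjugate_sub_le hd0 hd0 le_rfl hd1 hη
      have e1 : k * d * k + Φ P₁ + D' - 1 = (k * d * k - d) + (D' - D) := by
        rw [hDdef, hΦp]; abel
      rw [e1]
      rw [hsη] at h1
      refine (norm_add_le _ _).trans ?_
      linarith
    · replace ha0 : 0 ≤ a := ha0
      replace ha1 : ‖a‖ ≤ 1 := by simpa using ha1
      have haT : a ∈ T.image fun x => x.snd := Finset.mem_image.mpr ⟨_, hb, rfl⟩
      set b := v * a * v with hbdef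
      have hbT : b ∈ (T.image fun x => x.snd).image fun a => v * a * v :=
        Finset.mem_image_of_mem _ haT
      have hb0 : 0 ≤ b := hvs.conjugate_nonneg ha0
      have hab : ‖a - b‖ ≤ e₀ := by rw [norm_sub_rev]; exact (hvT a haT).2
      have hbv : b ≤ v * v := by
        have h1 : i b ≤ i (v * v) := by
          have h2 : i a ≤ 1 := le_one_of_norm_le_one (hi0 ha0) (by rw [hin]; exact ha1)
          have := (hvs.map i).conjugate_le_conjugate h2
          rwa [mul_one, ← map_mul, ← map_mul, ← map_mul] at this
        rw [← sub_nonneg, ← map_sub] at h1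
        exact sub_nonneg.mp (nonneg_of_map_nonneg i unitizationIncl_injective h1)
      set y := ψ b with hy
      have hy0 : 0 ≤ y := hψ.nonneg hb0
      have hyH : y ≤ H := hψ.mono hbv
      have hy1 : y ≤ 1 := hyH.trans hH1
      set z := p * y * p with hz
      have hpy : ‖z - y‖ ≤ 2 * Real.sqrt η :=
        norm_conjugate_sub_le hy0 hyH hy1 hp.isSelfAdjoint hp.norm_le hpη
      have hz0 : 0 ≤ z := hp.isSelfAdjoint.conjugate_nonneg hy0
      have hzp : z ≤ p := by
        have := hp.isSelfAdjoint.conjugate_le_conjugate hy1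
        rwa [mul_one, hp.isIdempotentElem.eq] at this
      have hz1 : z ≤ 1 := hzp.trans hp.le_one'
      have hι₁ : Function.Injective ι₁ := fun x y hxy => by rw [← h11 x, hxy, h11]
      have hψ'a : ψ' (i a) = ι₁ (ψ (u * a * u)) := by
        have h1 : unitizationCharacter A (i a) = 0 := rfl
        rw [hψ'x, unitalExtension_incl, h1, map_zero, add_zero, hus.star_eq]
      -- ψ' compresses a by u, while y comes from vav; these differ by at most 2e₀, and 1 + ε ≤ 2.
      have h1 : ‖φ' (p' * ψ' (i a) * p') - φ' (p' * ι₁ y * p')‖ ≤ 4 * e₀ := by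
        rw [← map_sub, ← sub_mul, ← mul_sub, hψ'a, ← map_sub, hy, ← map_sub]
        refine (hcontr _).trans ?_
        rw [NonUnitalStarAlgHom.norm_map ι₁ hι₁]
        have h2 : ‖u * a * u - b‖ ≤ 2 * e₀ := by
          have e1 : u * a * u - b = u * (a - b) * u + (u * b * u - b) := by noncomm_ring
          rw [e1]
          calc _ ≤ ‖u‖ * ‖a - b‖ * ‖u‖ + ‖u * b * u - b‖ :=
                (norm_add_le _ _).trans (by
                  gcongr; exact (norm_mul_le _ _).trans (by gcongr; exact norm_mul_le _ _))
            _ ≤ 1 * e₀ * 1 + e₀ := by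
                gcongr
                exact ((huT b (Finset.mem_insert_of_mem hbT)).2).trans hδe
            _ = 2 * e₀ := by ring
        calc (1 + ε) * ‖ψ (u * a * u - b)‖ ≤ (1 + 1) * (2 * e₀) := by
              gcongr
              exact (hψ1 _).trans h2
          _ = 4 * e₀ := by ring
      have h2 : φ' (p' * ι₁ y * p') = k * Φ (P₀ * z) * k + Φ (P₁ * z) := by
        have e0 : π₀ (p' * ι₁ y * p') = 0 := by rw [map_mul, map_mul, h01]; simp
        have e1 : π₁ (p' * ι₁ y * p') = z := by rw [map_mul, map_mul, h11, hπ₁p]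
        rw [hφ'x, e0, e1, zero_smul, add_zero]
      have h3 : ‖k * Φ (P₀ * z) * k - Φ (P₀ * z)‖ ≤ 2 * Real.sqrt η := by
        have hPz : 0 ≤ P₀ * z := blockProj_mul_nonneg _ hz0
        refine norm_cutoff_conjugate_sub_le hd0 (hΦ.nonneg hPz) (hΦ.mono ?_)
          (hΦ_one hPz ((blockProj_mul_le _ hz0).trans hz1)) hη
        have := blockProj_mul_nonneg (r := r) (fun i => c i = 0) (sub_nonneg.mpr hzp)
        rwa [mul_sub, sub_nonneg, ← hP₀def, hP₀p] at this
      have h4 : ‖Φ z - Φ y‖ ≤ 2 * Real.sqrt η := by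
        rw [← map_sub]; exact (hΦ1 _).trans hpy
      have h5 : ‖Φ y - i b‖ ≤ e₀ :=
        (hΦap (Finset.mem_insert_of_mem (Finset.mem_insert_of_mem hbT))).trans hδe
      have h6 : ‖i b - i a‖ ≤ e₀ := by rw [← map_sub, hin, norm_sub_rev]; exact hab
      have h7 : Φ z = Φ (P₀ * z) + Φ (P₁ * z) := by
        rw [← map_add, ← add_mul, hPadd, one_mul]
      change ‖φ' (p' * ψ' (i a) * p') - i a‖ ≤ ε
      have e1 : φ' (p' * ψ' (i a) * p') - i a =
          (φ' (p' * ψ' (i a) * p') - φ' (p' * ι₁ y * p')) +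
          (k * Φ (P₀ * z) * k - Φ (P₀ * z)) + (Φ z - Φ y) + (Φ y - i b) + (i b - i a) := by
        rw [h2, h7]; abel
      rw [e1]
      rw [hsη] at h3 h4
      refine (norm_add_le _ _).trans ?_
      refine (add_le_add_left ((norm_add_le _ _).trans (add_le_add_left
        ((norm_add_le _ _).trans (add_le_add_left (norm_add_le _ _) _)) _)) _).trans ?_
      linarith
  · intro j e f he hf hpe hpf hje hjf hef
    have hπproj {e : MatrixSum r'} (he : IsStarProjection e) : IsStarProjection (π₁ e) :=
      ⟨by rw [IsIdempotentElem, ← map_mul, he.isIdempotentElem.eq],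
        by rw [IsSelfAdjoint, ← map_star, he.isSelfAdjoint.star_eq]⟩
    have hblock {e : MatrixSum r'} (hje : blockProj r' (fun i => c' i = j) * e = e) :
        blockProj r (fun i => c i = j) * π₁ e = π₁ e := by
      have := congrArg π₁ hje
      rwa [hπ₁P] at this
    have hpπ {e : MatrixSum r'} (hpe : p' * e = e) : p * π₁ e = π₁ e := by
      rw [← hπ₁p, ← map_mul, hpe]
    have hef₁ : π₁ e * π₁ f = 0 := by rw [← map_mul, hef, map_zero]
    by_cases hj : j = 0
    · subst hj
      have hform {e : MatrixSum r'} (hb : P₀ * π₁ e = π₁ e) :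
          φ' e = k * Φ (π₁ e) * k + π₀ e • D' := by
        have : P₁ * π₁ e = 0 := by rw [← hb, ← mul_assoc, hP₁₀, zero_mul]
        rw [hφ'x, hb, this, map_zero, add_zero]
      have hbe := hblock hje
      have hbf := hblock hjf
      have hqe : q * π₁ e = π₁ e := by rw [← hP₀p, mul_assoc, hpπ hpe, hbe]
      have heq := hq.mul_eq_right_of_mul_eq_left (hπproj he) hqe
      have hsub := hq.sub_of_mul_eq (hπproj he) hqe
      have hP₀q : P₀ * q = q := by rw [hqdef, ← mul_assoc, hP₀.isIdempotentElem.eq]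
      have hPsub : P₀ * (q - π₁ e) = q - π₁ e := by rw [mul_sub, hP₀q, hbe]
      have key : (k * Φ (π₁ e) * k) * (k * Φ (π₁ f) * k) = 0 := by
        refine cutoff_conjugate_mul_eq_zero (hΦ.isSelfAdjoint_apply hq) ?_ ?_ ?_ η
        · exact hΦorth 0 (hπproj he) hsub hbe hPsub
            (by rw [mul_sub, heq, (hπproj he).isIdempotentElem.eq, sub_self])
        · exact hΦorth 0 hsub (hπproj he) hPsub hbe
            (by rw [sub_mul, hqe, (hπproj he).isIdempotentElem.eq, sub_self])
        · exact hΦorth 0 (hπproj he) (hπproj hf) hbe hbf hef₁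
      have h0 : π₀ e * π₀ f = 0 := by rw [← map_mul, hef, map_zero]
      -- The mixed terms contain kD' or D'k, and the scalar coordinates of e and f have product
      -- zero.
      rw [hform hbe, hform hbf, add_mul, mul_add, mul_add, key, smul_mul_smul_comm, h0, zero_smul,
        mul_smul_comm, smul_mul_assoc, mul_assoc _ k D', hkD', mul_zero, smul_zero,
        mul_assoc k _ k, ← mul_assoc D' k, hD'k, zero_mul, smul_zero,
        add_zero, add_zero]
    · have hform {e : MatrixSum r'} (hje : blockProj r' (fun i => c' i = j) * e = e) :
          φ' e = Φ (π₁ e) := by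
        have hb := hblock hje
        have h0 : P₀ * π₁ e = 0 := by
          rw [← hb, ← mul_assoc, hP₀def, blockProj_mul_blockProj_of_disjoint
            fun i h1 h2 => hj (h2.symm.trans h1), zero_mul]
        have h1 : P₁ * π₁ e = π₁ e := by
          calc P₁ * π₁ e = P₀ * π₁ e + P₁ * π₁ e := by rw [h0, zero_add]
            _ = π₁ e := by rw [← add_mul, hPadd, one_mul]
        have h2 : π₀ e = 0 := by
          rw [← hje]
          exact hπ₀P _ _ (fun h => hj h.symm)
        rw [hφ'x, h0, h1, h2, map_zero, mul_zero, zero_mul, zero_smul, zero_add, add_zero]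
      rw [hform hje, hform hjf]
      exact hΦorth j (hπproj he) (hπproj hf) (hblock hje) (hblock hjf) hef₁

end LowerBound

theorem proposition3p13 {A : Type*} [NonUnitalCStarAlgebra A] [PartialOrder A] [StarOrderedRing A]
    [TopologicalSpace.SeparableSpace A] :
    decompositionRank A = decompositionRank (Unitization ℂ A) := by
  have (n : ℕ) : DecompositionRankLE A n ↔ DecompositionRankLE (Unitization ℂ A) n :=
    ⟨DecompositionRankLE.unitization, DecompositionRankLE.of_unitization⟩
  simp only [decompositionRank, this]
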